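/- **Setting.** For a real Hilbert space $\mathcal E$ let $\Gamma(\mathcal E)$ be the set of proper, convex, lower semicontinuous functions $\mathcal E\to\mathbb R\cup\{\pm\infty\}$. For functions on $\mathcal E$ write $\operatorname{dom}f=\{x: f(x)<+\infty\}$, $f^*(u)=\sup_x\{\langle u,x\rangle-f(x)\}$, $(f\Box g)(x)=\inf_y\{f(y)+g(x-y)\}$, $\partial f(x)=\{v: f(y)\ge f(x)+\langle v,y-x\rangle\ \forall y\}$ if $f(x)\in\mathbb R$ and $\partial f(x)=\emptyset$ otherwise; $f$ is $\gamma$-strongly convex if $f-\frac\gamma2\|\cdot\|^2$ is convex; for $f\in\Gamma(\mathcal E)$ and $\tau>0$, $\operatorname{prox}_{\tau f}(x)$ is the unique minimizer of $y\mapsto f(y)+\frac1{2\tau}\|y-x\|^2$. The parallel sum of set-valued operators is $A\Box B=(A^{-1}+B^{-1})^{-1}$. For convex $S$, $\operatorname{sqri}S=\{x\in S:\bigcup_{\lambda>0}\lambda(S-x)\text{ is a closed linear subspace}\}$. **Problem.** Let $\mathcal H$ be a real Hilbert space, $z\in\mathcal H$, $f\in\Gamma(\mathcal H)$, and let $h:\mathcal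 H\to\mathbb R$ be convex and differentiable with $\eta$-Lipschitzian gradient, $\eta>0$. Let $m\ge1$ and, for $i=1,\dots,m$, let $\mathcal G_i$ be a real Hilbert space, $r_i\in\mathcal G_i$, $g_i,l_i\in\Gamma(\mathcal G_i)$ with $l_i$ being $\nu_i^{-1}$-strongly convex, $\nu_i>0$, and $L_i:\mathcal H\to\mathcal G_i$ a nonzero continuous linear operator. Consider the primal problem $$(P)\quad \inf_{x\in\mathcal H}\Big\{f(x)+\sum_{i=1}^m(g_i\Box l_i)(L_ix-r_i)+h(x)-\langle x,z\rangle\Big\}$$ and the dual problem $$(D)\quad \sup_{v_i\in\mathcal G_i}\Big\{-(f^*\Box h^*)\Big(z-\sum_{i=1}^mL_i^*v_i\Big)-\sum_{i=1}^m\big(g_i^*(v_i)+l_i^*(v_i)+\langle v_i,r_i\rangle\big)\Big\}.$$ **Theorem.** Suppose that $f+h$ is $\gamma$-strongly convex with $\gamma>0$, that $g_i^*+l_i^*$ is $\delta_i$-strongly convex with $\delta_i>0$ for $i=1,\dots,m$, and that $$(r_1,\dots,r_m)\in\operatorname{sqri}\Big(\prod_{i=1}^m(\operatorname{dom}g_i+\operatorname{dom}l_i)-\{(L_1x,\dots,L_mx):x\in\operatorname{dom}f\}\Big).$$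 Then there exist a unique optimal solution $\bar x$ to $(P)$ and a unique optimal solution $(\bar v_1,\dots,\bar v_m)$ to $(D)$; they fulfill the optimality conditions $$z-\sum_{i=1}^mL_i^*\bar v_i\in\partial f(\bar x)+\nabla h(\bar x)\quad\text{and}\quad \bar v_i\in(\partial g_i\Box\partial l_i)(L_i\bar x-r_i),\ i=1,\dots,m,$$ and the optimal objective values of $(P)$ and $(D)$ coincide. Moreover, let $\mu>0$ satisfy $\mu\le\min\Big\{\gamma^2/\eta^2,\ \delta_1^2/\nu_1^2,\dots,\delta_m^2/\nu_m^2,\ \sqrt{\gamma/\big(\sum_{i=1}^m\|L_i\|^2/\delta_i\big)}\Big\}$, let $\tau=\mu/(2\gamma)$, $\sigma_i=\mu/(2\delta_i)$, $\theta\in[2/(2+\mu),1]$, let $(x_0,v_{1,0},\dots,v_{m,0})\in\mathcal H\times\mathcal G_1\times\dots\times\mathcal G_m$ be arbitrary, and for $n\ge0$ set $$\begin{aligned}x_{n+1}&=\operatorname{prox}_{\tau f}\Big[x_n-\tau\Big(\sum_{i=1}^mL_i^*v_{i,n}+\nabla h(x_n)-z\Big)\Big],\\ y_n&=x_{n+1}+\theta(x_{n+1}-x_n),\\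 v_{i,n+1}&=\operatorname{prox}_{\sigma_ig_i^*}\big[v_{i,n}+\sigma_i(L_iy_n-\nabla l_i^*(v_{i,n})-r_i)\big],\quad i=1,\dots,m.\end{aligned}$$ Then, with $\omega=\frac{2(1+\theta)}{4+\mu}$, one has $0<\omega<1$ and for all $n\ge0$ $$\begin{aligned}&\gamma\|x_{n+1}-\bar x\|^2+(1-\omega)\sum_{i=1}^m\delta_i\|v_{i,n}-\bar v_i\|^2\\&\quad\le\omega^n\Big(\gamma\|x_1-\bar x\|^2+\sum_{i=1}^m\delta_i\|v_{i,0}-\bar v_i\|^2+\frac\gamma2\omega\|x_1-x_0\|^2+\mu\omega\sum_{i=1}^m\langle L_i(x_1-x_0),v_{i,0}-\bar v_i\rangle\Big).\end{aligned}$$ -/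

import Mathlib

open scoped Pointwise

noncomputable section

namespace PrimalDual

section Basic

variable {E : Type*} [NormedAddCommGroup E] [InnerProductSpace ℝ E]

/-- The effective domain of an extended real-valued function. -/
def effDom (f : E → EReal) : Set E := {x | f x < ⊤}

/-- Properness: nonempty effective domain and no value `-∞`. -/
def IsProper (f : E → EReal) : Prop := (effDom f).Nonempty ∧ ∀ x, f x ≠ ⊥

/-- Convexity of an extended real-valued function: the epigraph is a convex set. -/
def IsConvexFun (f : E → EReal) : Prop :=
  Convex ℝ {p : E × ℝ | f p.1 ≤ (p.2 : EReal)}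

/-- The class `Γ(E)` of proper, convex and lower semicontinuous functions. -/
structure IsGamma (f : E → EReal) : Prop where
  proper : IsProper f
  convex : IsConvexFun f
  lsc : LowerSemicontinuous f

/-- `f` is `γ`-strongly convex: `f - (γ / 2) ‖·‖²` is convex. -/
def IsStronglyConvex (γ : ℝ) (f : E → EReal) : Prop :=
  IsConvexFun fun x => f x - ((γ / 2 * ‖x‖ ^ 2 : ℝ) : EReal)

/-- The conjugate function `f*(u) = sup_x (⟨u, x⟩ - f x)`. -/
def conj (f : E → EReal) (u : E) : EReal := ⨆ x : E, ((inner ℝ u x : ℝ) : EReal) - f x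

/-- The infimal convolution `(f □ g)(x) = inf_y (f y + g (x - y))`. -/
def infConv (f g : E → EReal) (x : E) : EReal := ⨅ y : E, f y + g (x - y)

/-- The subdifferential of `f` at `x`, empty where `f x` is not finite. -/
def subdiff (f : E → EReal) (x : E) : Set E :=
  {v | f x ≠ ⊤ ∧ f x ≠ ⊥ ∧ ∀ y : E, f x + ((inner ℝ v (y - x) : ℝ) : EReal) ≤ f y}

/-- The inverse of a set-valued operator. -/
def opInv (A : E → Set E) (u : E) : Set E := {x | u ∈ A x}

/-- The parallel sum `A □ B = (A⁻¹ + B⁻¹)⁻¹` of two set-valued operators. -/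
def parSum (A B : E → Set E) : E → Set E := opInv fun u => opInv A u + opInv B u

/-- The proximal point of parameter `γ` of `f` at `x`, that is, the minimizer of
`y ↦ f y + (1 / (2γ)) ‖y - x‖²` (which exists and is unique for `f ∈ Γ(E)`, `γ > 0`,
`E` complete). -/
def prox (γ : ℝ) (f : E → EReal) (x : E) : E :=
  Classical.epsilon fun p : E =>
    ∀ y : E, f p + ((1 / (2 * γ) * ‖p - x‖ ^ 2 : ℝ) : EReal) ≤
      f y + ((1 / (2 * γ) * ‖y - x‖ ^ 2 : ℝ) : EReal)

end Basic

/-- The strong quasi-relative interior of `S`: the points `x ∈ S` such that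
`⋃_{c > 0} c (S - x)` is a closed linear subspace. -/
def sqri {E : Type*} [AddCommGroup E] [Module ℝ E] [TopologicalSpace E] (S : Set E) : Set E :=
  {x | x ∈ S ∧ ∃ K : Submodule ℝ E, IsClosed (K : Set E) ∧
    (K : Set E) = ⋃ c ∈ Set.Ioi (0 : ℝ), c • (S - {x})}

section Problem

variable {H : Type*} [NormedAddCommGroup H] [InnerProductSpace ℝ H] [CompleteSpace H]
  {m : ℕ} {G : Fin m → Type*} [∀ i, NormedAddCommGroup (G i)]
  [∀ i, InnerProductSpace ℝ (G i)] [∀ i, CompleteSpace (G i)]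

/-- The primal objective
`x ↦ f x + ∑ i, (g i □ l i) (L i x - r i) + h x - ⟨x, z⟩`. -/
def primalObj (z : H) (f : H → EReal) (h : H → ℝ) (r : ∀ i, G i) (g l : ∀ i, G i → EReal)
    (L : ∀ i, H →L[ℝ] G i) (x : H) : EReal :=
  f x + ∑ i, infConv (g i) (l i) (L i x - r i) + (h x : EReal) - ((inner ℝ x z : ℝ) : EReal)

/-- The dual objective
`v ↦ -(f* □ h*) (z - ∑ i, (L i)* (v i)) - ∑ i, ((g i)* (v i) + (l i)* (v i) + ⟨v i, r i⟩)`. -/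
def dualObj (z : H) (f : H → EReal) (h : H → ℝ) (r : ∀ i, G i) (g l : ∀ i, G i → EReal)
    (L : ∀ i, H →L[ℝ] G i) (v : ∀ i, G i) : EReal :=
  -infConv (conj f) (conj fun x => (h x : EReal))
      (z - ∑ i, ContinuousLinearMap.adjoint (L i) (v i)) -
    ∑ i, (conj (g i) (v i) + conj (l i) (v i) + ((inner ℝ (v i) (r i) : ℝ) : EReal))

end Problem

end PrimalDual

end

open PrimalDual

namespace PrimalDual

/-! ### Extended-valued convex functions through their epigraphs: minorants, minimizers,
subgradients. -/

section Epigraph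

variable {E : Type*} [NormedAddCommGroup E] [InnerProductSpace ℝ E]

/-! Duality. Strong convexity of `l i` makes its conjugate finite and smooth. Strong convexity of `g
i* + l i*` then makes `g i □ l i` finite, exact and smooth with a gradient `T i`
(`IsGamma.exists_infConv_eq_smooth`). The primal objective is therefore `f + h`, strongly convex,
plus a smooth convex function, and it has a minimizer `xbar`. Put `vbar i = T i (L i xbar - r i)`.
The first-order condition at `xbar` is the first optimality condition, and equality in Fenchel–Young
closes the duality gap. Both objectives grow quadratically away from these points, which gives
uniqueness.

Rate. The primal and the dual update are both forward-backward steps for a strongly convex sum, so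
`forward_backward_step` serves for both: strong monotonicity gains a factor `1 + μ / 2`, after half
of the gain has paid for evaluating the gradient at the old point. In the sum of the two estimates
the bilinear terms at the new points cancel. What remains is the extrapolation error, which
`coupling_le` splits into squares. The value of `ω` is the one for which the surplus on the dual
side is exactly `θ - ω`, and the lower bound on `θ` says `ω ≤ θ`. A Lyapunov function then contracts
by `ω` at each step (`lyapunov_rate`). -/

lemma conj_le_coe_iff {f : E → EReal} {u : E} {c : ℝ} :
    conj f u ≤ c ↔ ∀ (x : E) (a : ℝ), f x ≤ a → inner ℝ u x - a ≤ c := by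
  unfold conj
  rw [iSup_le_iff]
  refine forall_congr' fun x => ?_
  induction hx : f x using EReal.rec with
  | bot =>
    constructor
    · intro h
      simp at h
    · intro h
      have := h (inner ℝ u x - c - 1) bot_le
      linarith
  | top => simp
  | coe b =>
    norm_cast
    constructor
    · intro h a hab
      linarith
    · intro h
      exact h b le_rfl

/-- Testing against all real `b ≥ f y`, rather than `f y` itself, moves the work from `EReal` to
real inequalities. The same device is used for conjugates, convexity and minimality. -/
lemma mem_subdiff_iff {f : E → EReal} {x v : E} :
    v ∈ subdiff f x ↔ ∃ a : ℝ, f x = a ∧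
      ∀ (y : E) (b : ℝ), f y ≤ b → a + inner ℝ v (y - x) ≤ b := by
  constructor
  · rintro ⟨h1, h2, h3⟩
    refine ⟨(f x).toReal, (EReal.coe_toReal h1 h2).symm, fun y b hb => ?_⟩
    have := (h3 y).trans hb
    rw [← EReal.coe_toReal h1 h2] at this
    exact_mod_cast this
  · rintro ⟨a, ha, h⟩
    refine ⟨by simp [ha], by simp [ha], fun y => ?_⟩
    rw [ha]
    refine EReal.le_of_forall_lt_iff_le.1 fun b hb => ?_
    exact_mod_cast h y b hb.le

/-- `γ`-strong convexity in epigraph form, as an inequality along segments. -/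
def StrongConvexEpi (γ : ℝ) (F : E → EReal) : Prop :=
  ∀ (x y : E) (a b t : ℝ), F x ≤ a → F y ≤ b → 0 ≤ t → t ≤ 1 →
    F ((1 - t) • x + t • y) ≤
      (((1 - t) * a + t * b - γ / 2 * (t * (1 - t)) * ‖x - y‖ ^ 2 : ℝ) : EReal)

lemma norm_sq_segment (x y : E) (t : ℝ) :
    ‖(1 - t) • x + t • y‖ ^ 2 = (1 - t) * ‖x‖ ^ 2 + t * ‖y‖ ^ 2 - t * (1 - t) * ‖x - y‖ ^ 2 := by
  rw [norm_add_sq_real, norm_sub_sq_real, norm_smul, norm_smul, mul_pow, mul_pow,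
    inner_smul_left, inner_smul_right, Real.norm_eq_abs, Real.norm_eq_abs, sq_abs, sq_abs]
  simp
  ring

lemma sub_coe_le_coe_iff {a : EReal} {b c : ℝ} :
    a - (b : EReal) ≤ (c : EReal) ↔ a ≤ ((c + b : ℝ) : EReal) := by
  rw [EReal.sub_le_iff_le_add (by simp) (by simp)]
  norm_cast

lemma add_coe_le_coe_iff {a : EReal} {b c : ℝ} :
    a + (b : EReal) ≤ (c : EReal) ↔ a ≤ ((c - b : ℝ) : EReal) := by
  have := @sub_coe_le_coe_iff a (-b) c
  rw [sub_eq_add_neg, ← EReal.coe_neg, neg_neg] at this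
  rw [this, sub_eq_add_neg]

lemma IsConvexFun.strongConvexEpi {f : E → EReal} (hf : IsConvexFun f) : StrongConvexEpi 0 f := by
  intro x y a b t hx hy h0 h1
  have := hf (x := (x, a)) (by simpa using hx) (y := (y, b)) (by simpa using hy)
    (a := 1 - t) (b := t) (by linarith) h0 (by ring)
  simpa using this

lemma StrongConvexEpi.isConvexFun {f : E → EReal} (hf : StrongConvexEpi 0 f) : IsConvexFun f := by
  rintro ⟨x, a⟩ hx ⟨y, b⟩ hy s t hs ht hst
  obtain rfl : s = 1 - t := by linarith
  have := hf x y a b t hx hy ht (by linarith)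
  simpa using this

lemma IsStronglyConvex.strongConvexEpi {γ : ℝ} {f : E → EReal} (hf : IsStronglyConvex γ f) :
    StrongConvexEpi γ f := by
  intro x y a b t hx hy h0 h1
  have key := (IsConvexFun.strongConvexEpi hf) x y (a - γ / 2 * ‖x‖ ^ 2) (b - γ / 2 * ‖y‖ ^ 2) t
    (by rw [sub_coe_le_coe_iff]; simpa using hx) (by rw [sub_coe_le_coe_iff]; simpa using hy) h0 h1
  simp only at key
  rw [sub_coe_le_coe_iff, norm_sq_segment] at key
  convert key using 2
  ring

/-- Adding a finite strongly convex function adds the moduli of strong convexity. -/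
lemma StrongConvexEpi.add_coe {γ β : ℝ} {f : E → EReal} {S : E → ℝ} (hf : StrongConvexEpi γ f)
    (hS : StrongConvexEpi β fun x => (S x : EReal)) :
    StrongConvexEpi (γ + β) fun x => f x + (S x : EReal) := by
  intro x y a b t hx hy h0 h1
  simp only [add_coe_le_coe_iff] at hx hy ⊢
  have h2 := hS x y (S x) (S y) t le_rfl le_rfl h0 h1
  refine (hf x y _ _ t hx hy h0 h1).trans ?_
  simp only [EReal.coe_le_coe_iff] at h2 ⊢
  linarith

/-- A function is bounded below by a downward cone if it is convex and bounded below on a ball. -/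
lemma StrongConvexEpi.exists_cone_minorant {f : E → EReal} (hf : StrongConvexEpi 0 f) {x₀ : E}
    {a c r : ℝ} (ha : f x₀ ≤ a) (hr : 0 < r) (hc : ∀ y, ‖y - x₀‖ < r → ∀ b : ℝ, f y ≤ b → c ≤ b) :
    ∃ d, 0 ≤ d ∧ ∀ (y : E) (b : ℝ), f y ≤ b → c - d * ‖y - x₀‖ ≤ b := by
  have hca : c ≤ a := hc x₀ (by simpa using hr) a ha
  refine ⟨(a - c) * 2 / r, by have := sub_nonneg.2 hca; positivity, fun y b hb => ?_⟩
  by_cases hy : ‖y - x₀‖ < r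
  · have := hc y hy b hb
    have h3 : 0 ≤ (a - c) * 2 / r * ‖y - x₀‖ := by have := sub_nonneg.2 hca; positivity
    linarith
  · push Not at hy
    set D := ‖y - x₀‖ with hD
    have hDp : 0 < D := hr.trans_le hy
    -- With this `t` the point of the segment from `x₀` to `y` lies at distance `r / 2` from `x₀`,
    -- inside the ball where `c` is a lower bound.
    set t := r / (2 * D) with ht
    have htp : 0 < t := by positivity
    have ht1 : t ≤ 1 := by
      rw [ht, div_le_one (by positivity)]
      linarith
    have h4 := hf x₀ y a b t ha hb htp.le ht1
    have h5 := hc _ (by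
      have : (1 - t) • x₀ + t • y - x₀ = t • (y - x₀) := by module
      rw [this, norm_smul, Real.norm_of_nonneg htp.le, ← hD, ht]
      field_simp
      linarith) _ h4
    have h6 : (a - c) * 2 / r * D = (a - c) / t := by
      rw [ht]
      field_simp
    rw [h6]
    have h7 : (a - c) / t * t = a - c := by field_simp
    by_contra hcon
    push Not at hcon
    have : t * b < t * (c - (a - c) / t) := mul_lt_mul_of_pos_left hcon htp
    nlinarith

lemma exists_ball_lower_bound {E : Type*} [NormedAddCommGroup E] {f : E → EReal} (hf : LowerSemicontinuous f)
    {x₀ : E} {a : ℝ} (ha : (a : EReal) < f x₀) :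
    ∃ r, 0 < r ∧ ∀ y, ‖y - x₀‖ < r → ∀ b : ℝ, f y ≤ b → a ≤ b := by
  obtain ⟨r, hr, h⟩ := Metric.eventually_nhds_iff.1 (hf x₀ a ha)
  refine ⟨r, hr, fun y hy b hb => ?_⟩
  have := (h (by rwa [dist_eq_norm])).trans_le hb
  exact_mod_cast this.le

lemma IsProper.exists_coe {E : Type*} {f : E → EReal} (hf : IsProper f) : ∃ (x : E) (a : ℝ), f x = a := by
  obtain ⟨⟨x, hx⟩, h⟩ := hf
  exact ⟨x, (f x).toReal, (EReal.coe_toReal (ne_of_lt hx) (h x)).symm⟩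

/-- A function in `Γ(E)` is minorized by a cone around any point. -/
lemma IsGamma.exists_cone_minorant {f : E → EReal} (hf : IsGamma f) (z : E) :
    ∃ c d : ℝ, 0 ≤ d ∧ ∀ (y : E) (b : ℝ), f y ≤ b → c - d * ‖y - z‖ ≤ b := by
  obtain ⟨x, a, ha⟩ := hf.proper.exists_coe
  obtain ⟨r, hr, h⟩ := exists_ball_lower_bound hf.lsc (x₀ := x) (a := a - 1)
    (by rw [ha]; exact_mod_cast sub_one_lt a)
  obtain ⟨d, hd, h'⟩ := hf.convex.strongConvexEpi.exists_cone_minorant ha.le hr h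
  refine ⟨a - 1 - d * ‖z - x‖, d, hd, fun y b hb => ?_⟩
  have h1 := h' y b hb
  have h2 : ‖y - x‖ ≤ ‖y - z‖ + ‖z - x‖ := norm_sub_le_norm_sub_add_norm_sub y z x
  nlinarith

/-- Removing the quadratic `γ / 2 * ‖y - x‖ ^ 2` leaves a convex function, which has a cone
minorant; the quadratic, once restored, dominates the linear decrease of the cone. -/
lemma StrongConvexEpi.bddBelow {F : E → EReal} {γ : ℝ} (hγ : 0 < γ) (hF : StrongConvexEpi γ F)
    (hlsc : LowerSemicontinuous F) (hp : IsProper F) :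
    ∃ c : ℝ, ∀ (y : E) (b : ℝ), F y ≤ b → c ≤ b := by
  obtain ⟨x, a, ha⟩ := hp.exists_coe
  obtain ⟨r, hr, h⟩ := exists_ball_lower_bound hlsc (x₀ := x) (a := a - 1)
    (by rw [ha]; exact_mod_cast sub_one_lt a)
  have hq : StrongConvexEpi (-γ) fun y : E => ((-(γ / 2) * ‖y - x‖ ^ 2 : ℝ) : EReal) := by
    intro y y' b b' t hb hb' h0 h1
    have e : (1 - t) • y + t • y' - x = (1 - t) • (y - x) + t • (y' - x) := by module
    simp only [EReal.coe_le_coe_iff] at hb hb' ⊢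
    rw [e, norm_sq_segment, sub_sub_sub_cancel_right]
    nlinarith
  have h0 := hF.add_coe hq
  rw [add_neg_cancel] at h0
  obtain ⟨d, hd, h'⟩ := h0.exists_cone_minorant (x₀ := x) (a := a) (c := a - 1 - γ / 2 * r ^ 2)
    (by simp [ha]) hr (by
    intro y hy b hb
    rw [add_coe_le_coe_iff] at hb
    have h1 := h y hy _ hb
    have h2 : ‖y - x‖ ^ 2 ≤ r ^ 2 := by gcongr
    nlinarith)
  refine ⟨a - 1 - γ / 2 * r ^ 2 - d ^ 2 / (2 * γ), fun y b hb => ?_⟩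
  have h1 := h' y (b - γ / 2 * ‖y - x‖ ^ 2) (by
    rw [add_coe_le_coe_iff]
    convert hb using 2
    ring)
  have h2 : d * ‖y - x‖ ≤ γ / 2 * ‖y - x‖ ^ 2 + d ^ 2 / (2 * γ) := by
    have : 0 ≤ (γ * ‖y - x‖ - d) ^ 2 / (2 * γ) := by positivity
    have e : (γ * ‖y - x‖ - d) ^ 2 / (2 * γ) =
      γ / 2 * ‖y - x‖ ^ 2 + d ^ 2 / (2 * γ) - d * ‖y - x‖ := by
      field_simp
      ring
    linarith
  linarith

/-- A proper, strongly convex and lower semicontinuous function on a Hilbert space attains its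
minimum, at a point where it is finite. -/
lemma StrongConvexEpi.exists_minimizer [CompleteSpace E] {F : E → EReal} {γ : ℝ} (hγ : 0 < γ)
    (hF : StrongConvexEpi γ F) (hlsc : LowerSemicontinuous F) (hp : IsProper F) :
    ∃ (x : E) (a : ℝ), F x = a ∧ ∀ (y : E) (b : ℝ), F y ≤ b → a ≤ b := by
  obtain ⟨c, hc⟩ := hF.bddBelow hγ hlsc hp
  set V : Set ℝ := {b | ∃ y, F y ≤ b} with hV
  have hVb : BddBelow V := ⟨c, by rintro b ⟨y, hy⟩; exact hc y b hy⟩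
  obtain ⟨x₀, a₀, h₀⟩ := hp.exists_coe
  have hVn : V.Nonempty := ⟨a₀, x₀, h₀.le⟩
  set s := sInf V with hs
  have hsle : ∀ (y : E) (b : ℝ), F y ≤ b → s ≤ b := fun y b hb => csInf_le hVb ⟨y, hb⟩
  have hex : ∀ n : ℕ, ∃ y, F y ≤ ((s + 1 / ((n : ℝ) + 1) : ℝ) : EReal) := by
    intro n
    obtain ⟨b, ⟨y, hy⟩, hb⟩ := Real.lt_sInf_add_pos hVn (ε := 1 / ((n : ℝ) + 1)) (by positivity)
    exact ⟨y, hy.trans (by exact_mod_cast hb.le)⟩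
  choose u hu using hex
  have hdist : ∀ N n m : ℕ, N ≤ n → N ≤ m → ‖u n - u m‖ ^ 2 ≤ 8 / γ * (1 / ((N : ℝ) + 1)) := by
    intro N n m hn hm
    have mono : ∀ k : ℕ, N ≤ k → F (u k) ≤ ((s + 1 / ((N : ℝ) + 1) : ℝ) : EReal) := by
      intro k hk
      refine (hu k).trans ?_
      have : (1 : ℝ) / ((k : ℝ) + 1) ≤ 1 / ((N : ℝ) + 1) := Nat.one_div_le_one_div hk
      exact_mod_cast (by linarith : s + 1 / ((k : ℝ) + 1) ≤ s + 1 / ((N : ℝ) + 1))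
    -- The midpoint of two almost minimizers cannot fall below the infimum, so strong convexity
    -- forces them to be close: a minimizing sequence is Cauchy.
    have h1 := hsle _ _ (hF _ _ _ _ (1 / 2) (mono n hn) (mono m hm) (by norm_num) (by norm_num))
    have h2 : γ / 8 * ‖u n - u m‖ ^ 2 ≤ 1 / ((N : ℝ) + 1) := by linarith
    rw [div_mul_eq_mul_div, le_div_iff₀ hγ]
    linarith
  have hcau : CauchySeq u := by
    refine cauchySeq_of_le_tendsto_0 (fun N : ℕ => √(8 / γ * (1 / ((N : ℝ) + 1)))) ?_ ?_
    · intro n m N hn hm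
      rw [dist_eq_norm]
      exact Real.le_sqrt_of_sq_le (hdist N n m hn hm)
    · have h1 := (tendsto_one_div_add_atTop_nhds_zero_nat (𝕜 := ℝ)).const_mul (8 / γ)
      have h2 := h1.sqrt
      simpa using h2
  obtain ⟨x, hx⟩ := cauchySeq_tendsto_of_complete hcau
  have hle : F x ≤ s := by
    refine EReal.ge_of_forall_gt_iff_ge.1 fun c hcx => ?_
    have h1 := hx.eventually (hlsc x c hcx)
    have h2 : Filter.Tendsto (fun n : ℕ => s + 1 / ((n : ℝ) + 1)) Filter.atTop (nhds (s + 0)) :=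
      tendsto_one_div_add_atTop_nhds_zero_nat.const_add s
    rw [add_zero] at h2
    have h3 : c ≤ s := ge_of_tendsto h2 (h1.mono fun n hn => by
      exact_mod_cast (hn.trans_le (hu n)).le)
    exact_mod_cast h3
  refine ⟨x, s, le_antisymm hle ?_, hsle⟩
  refine EReal.le_of_forall_lt_iff_le.1 fun b hb => ?_
  exact_mod_cast hsle x b hb.le

/-- Let `t → 0` in an inequality. -/
lemma le_of_forall_le_add_mul {p q C : ℝ} (h : ∀ t : ℝ, 0 < t → t ≤ 1 → p ≤ q + t * C) : p ≤ q := by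
  have h1 : Filter.Tendsto (fun t : ℝ => q + t * C) (nhdsWithin 0 (Set.Ioi 0)) (nhds (q + 0 * C)) :=
    ((continuous_const.add (continuous_id.mul continuous_const)).tendsto 0).mono_left
      nhdsWithin_le_nhds
  rw [zero_mul, add_zero] at h1
  refine ge_of_tendsto h1 ?_
  filter_upwards [Ioc_mem_nhdsGT (zero_lt_one' ℝ)] with t ht using h t ht.1 ht.2

/-- First-order optimality for the sum of a convex function and a function with a quadratic upper
bound at the minimizer. -/
lemma StrongConvexEpi.subgradient_of_isMin {f : E → EReal} (hf : StrongConvexEpi 0 f) {S : E → ℝ}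
    {x s : E} {a C : ℝ} (ha : f x = a)
    (hS : ∀ y, S y ≤ S x + inner ℝ s (y - x) + C * ‖y - x‖ ^ 2)
    (hmin : ∀ (y : E) (b : ℝ), f y ≤ b → a + S x ≤ b + S y) :
    -s ∈ subdiff f x := by
  refine mem_subdiff_iff.2 ⟨a, ha, fun y b hb => ?_⟩
  refine le_of_forall_le_add_mul (C := C * ‖y - x‖ ^ 2) fun t h0 h1 => ?_
  have h2 := hmin _ _ (hf x y a b t ha.le hb h0.le h1)
  have h3 := hS ((1 - t) • x + t • y)
  have e : (1 - t) • x + t • y - x = t • (y - x) := by module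
  rw [e, norm_smul, inner_smul_right, Real.norm_of_nonneg h0.le, mul_pow] at h3
  rw [inner_neg_left]
  have h4 : 0 ≤ t * (b + t * (C * ‖y - x‖ ^ 2) - (a + -inner ℝ s (y - x))) := by nlinarith
  have := (mul_nonneg_iff_of_pos_left h0).1 h4
  linarith

/-- Apply the subgradient inequality at the point `t` of the segment, compare with strong convexity,
divide by `t` and let `t → 0`. With `v = 0` this is quadratic growth at a minimizer. -/
lemma StrongConvexEpi.add_le_of_mem_subdiff {γ : ℝ} {F : E → EReal} (hF : StrongConvexEpi γ F)
    {x v : E} {a : ℝ} (ha : F x = a) (hv : v ∈ subdiff F x) {y : E} {b : ℝ} (hb : F y ≤ b) :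
    a + inner ℝ v (y - x) + γ / 2 * ‖y - x‖ ^ 2 ≤ b := by
  obtain ⟨a', ha', hv⟩ := mem_subdiff_iff.1 hv
  obtain rfl : a' = a := by exact_mod_cast ha'.symm.trans ha
  refine le_of_forall_le_add_mul (C := γ / 2 * ‖y - x‖ ^ 2) fun t h0 h1 => ?_
  have h2 := hv _ _ (hF x y a' b t ha.le hb h0.le h1)
  have e : (1 - t) • x + t • y - x = t • (y - x) := by module
  rw [e, inner_smul_right, norm_sub_rev] at h2
  have h4 : 0 ≤ t * (b + t * (γ / 2 * ‖y - x‖ ^ 2) -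
      (a' + inner ℝ v (y - x) + γ / 2 * ‖y - x‖ ^ 2)) := by nlinarith
  have := (mul_nonneg_iff_of_pos_left h0).1 h4
  linarith

/-- The subdifferential of a strongly convex function is strongly monotone. -/
lemma StrongConvexEpi.inner_ge_of_mem_subdiff {γ : ℝ} {F : E → EReal} (hF : StrongConvexEpi γ F)
    {x y u v : E} (hu : u ∈ subdiff F x) (hv : v ∈ subdiff F y) :
    γ * ‖x - y‖ ^ 2 ≤ inner ℝ (u - v) (x - y) := by
  obtain ⟨a, ha, -⟩ := mem_subdiff_iff.1 hu
  obtain ⟨b, hb, -⟩ := mem_subdiff_iff.1 hv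
  have h1 := hF.add_le_of_mem_subdiff ha hu hb.le
  have h2 := hF.add_le_of_mem_subdiff hb hv ha.le
  rw [norm_sub_rev, ← neg_sub x y, inner_neg_right] at h1
  rw [inner_sub_left]
  linarith

lemma lowerSemicontinuous_add_coe {E : Type*} [TopologicalSpace E] {f : E → EReal} (hf : LowerSemicontinuous f) {S : E → ℝ}
    (hS : Continuous S) : LowerSemicontinuous fun x => f x + (S x : EReal) :=
  hf.add' (continuous_coe_real_ereal.comp hS).lowerSemicontinuous fun x =>
    EReal.continuousAt_add (by simp) (by simp)

lemma isProper_add_coe {E : Type*} {f : E → EReal} (hf : IsProper f) (S : E → ℝ) :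
    IsProper fun x => f x + (S x : EReal) := by
  obtain ⟨x, a, ha⟩ := hf.exists_coe
  refine ⟨⟨x, ?_⟩, fun y => ?_⟩
  · simp only [effDom, Set.mem_ofPred_eq, ha]
    exact_mod_cast EReal.coe_lt_top (a + S x)
  · simp [EReal.add_eq_bot_iff, hf.2 y]

end Epigraph

/-! ### Conjugates, proximal points and the Fenchel–Moreau theorem. -/

section Conjugate

variable {E : Type*} [NormedAddCommGroup E] [InnerProductSpace ℝ E]

lemma mem_subdiff_add {f g : E → EReal} {x u w : E} (hu : u ∈ subdiff f x) (hw : w ∈ subdiff g x) :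
    u + w ∈ subdiff (fun y => f y + g y) x := by
  obtain ⟨a, ha, -⟩ := mem_subdiff_iff.1 hu
  obtain ⟨b, hb, -⟩ := mem_subdiff_iff.1 hw
  refine ⟨by simp only [ha, hb]; exact_mod_cast EReal.coe_ne_top _,
    by simp only [ha, hb]; exact_mod_cast EReal.coe_ne_bot _, fun y => ?_⟩
  refine le_trans (le_of_eq ?_) (add_le_add (hu.2.2 y) (hw.2.2 y))
  rw [inner_add_left, EReal.coe_add]
  exact add_add_add_comm _ _ _ _

/-- Equality case of the Fenchel–Young inequality. -/
lemma conj_eq_of_mem_subdiff {f : E → EReal} {x v : E} {a : ℝ} (ha : f x = a)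
    (hv : v ∈ subdiff f x) : conj f v = ((inner ℝ v x - a : ℝ) : EReal) := by
  obtain ⟨a', ha', h⟩ := mem_subdiff_iff.1 hv
  obtain rfl : a' = a := by exact_mod_cast ha'.symm.trans ha
  refine le_antisymm (conj_le_coe_iff.2 fun y b hb => ?_) ?_
  · have := h y b hb
    rw [inner_sub_right] at this
    linarith
  · refine EReal.le_of_forall_lt_iff_le.1 fun c hc => ?_
    exact_mod_cast conj_le_coe_iff.1 hc.le x a' ha.le

lemma mem_subdiff_conj {f : E → EReal} {x v : E} (hv : v ∈ subdiff f x) :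
    x ∈ subdiff (conj f) v := by
  obtain ⟨a, ha, -⟩ := mem_subdiff_iff.1 hv
  refine mem_subdiff_iff.2 ⟨_, conj_eq_of_mem_subdiff ha hv, fun w c hc => ?_⟩
  have := conj_le_coe_iff.1 hc x a ha.le
  rw [inner_sub_right, real_inner_comm w x, real_inner_comm v x]
  linarith

lemma conj_ne_bot {f : E → EReal} (hf : IsProper f) (u : E) : conj f u ≠ ⊥ := by
  obtain ⟨x, a, ha⟩ := hf.exists_coe
  intro h
  have := conj_le_coe_iff.1 (h.le.trans (bot_le (a := ((inner ℝ u x - a - 1 : ℝ) : EReal)))) x a ha.le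
  linarith

lemma conj_isConvexFun (f : E → EReal) : IsConvexFun (conj f) := by
  refine StrongConvexEpi.isConvexFun fun u w a b t hu hw h0 h1 => ?_
  rw [conj_le_coe_iff] at hu hw ⊢
  intro x c hc
  have h2 := hu x c hc
  have h3 := hw x c hc
  rw [inner_add_left, inner_smul_left, inner_smul_left]
  simp only [conj_trivial]
  nlinarith

lemma conj_lowerSemicontinuous (f : E → EReal) : LowerSemicontinuous (conj f) := by
  refine lowerSemicontinuous_iSup fun x => ?_
  have hc : Continuous fun u : E => ((inner ℝ u x : ℝ) : EReal) :=
    continuous_coe_real_ereal.comp (by fun_prop)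
  induction hx : f x using EReal.rec with
  | bot => simpa using lowerSemicontinuous_const
  | top => simpa using lowerSemicontinuous_const
  | coe b =>
    have : Continuous fun u : E => ((inner ℝ u x - b : ℝ) : EReal) :=
      continuous_coe_real_ereal.comp (by fun_prop)
    exact_mod_cast this.lowerSemicontinuous

lemma strongConvexEpi_sq (β : ℝ) (z : E) :
    StrongConvexEpi β fun y : E => ((β / 2 * ‖y - z‖ ^ 2 : ℝ) : EReal) := by
  intro y y' b b' t hb hb' h0 h1
  have e : (1 - t) • y + t • y' - z = (1 - t) • (y - z) + t • (y' - z) := by module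
  simp only [EReal.coe_le_coe_iff] at hb hb' ⊢
  rw [e, norm_sq_segment, sub_sub_sub_cancel_right]
  nlinarith

section Complete

variable [CompleteSpace E]

/-- The proximal point is characterized by a subgradient inclusion. -/
lemma IsGamma.mem_subdiff_prox {f : E → EReal} (hf : IsGamma f) {τ : ℝ} (hτ : 0 < τ) (x : E) :
    τ⁻¹ • (x - prox τ f x) ∈ subdiff f (prox τ f x) := by
  have hq := strongConvexEpi_sq τ⁻¹ x
  have hF := hf.convex.strongConvexEpi.add_coe hq
  rw [zero_add] at hF
  have e : ∀ y : E, 1 / (2 * τ) * ‖y - x‖ ^ 2 = τ⁻¹ / 2 * ‖y - x‖ ^ 2 := by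
    intro y
    field_simp
  obtain ⟨p, a, hp, hmin⟩ := hF.exists_minimizer (inv_pos.2 hτ)
    (lowerSemicontinuous_add_coe hf.lsc (by fun_prop)) (isProper_add_coe hf.proper _)
  have hspec : ∀ y : E, f (prox τ f x) + ((1 / (2 * τ) * ‖prox τ f x - x‖ ^ 2 : ℝ) : EReal) ≤
      f y + ((1 / (2 * τ) * ‖y - x‖ ^ 2 : ℝ) : EReal) := by
    -- Existence of one minimizer suffices for `prox` to be a minimizer; uniqueness plays no role.
    refine Classical.epsilon_spec (p := fun p : E =>
      ∀ y : E, f p + ((1 / (2 * τ) * ‖p - x‖ ^ 2 : ℝ) : EReal) ≤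
        f y + ((1 / (2 * τ) * ‖y - x‖ ^ 2 : ℝ) : EReal)) ⟨p, fun y => ?_⟩
    rw [e, e, hp]
    refine EReal.le_of_forall_lt_iff_le.1 fun b hb => ?_
    exact_mod_cast hmin y b hb.le
  set q := prox τ f x
  have hqa : f q ≤ ((a - 1 / (2 * τ) * ‖q - x‖ ^ 2 : ℝ) : EReal) := by
    rw [← add_coe_le_coe_iff]
    refine (hspec p).trans ?_
    rw [e]
    exact hp.le
  have hfq : f q = ((f q).toReal : EReal) :=
    (EReal.coe_toReal (hqa.trans_lt (EReal.coe_lt_top _)).ne (hf.proper.2 q)).symm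
  have := hf.convex.strongConvexEpi.subgradient_of_isMin (S := fun y => τ⁻¹ / 2 * ‖y - x‖ ^ 2)
    (s := τ⁻¹ • (q - x)) (C := τ⁻¹ / 2) hfq
    (fun y => by
      have : y - x = (q - x) + (y - q) := by abel
      rw [this, norm_add_sq_real, inner_smul_left]
      simp only [conj_trivial]
      ring_nf
      exact le_rfl)
    (fun y b hb => by
      have h1 := (hspec y).trans (add_le_add_left hb _)
      rw [hfq, e, e] at h1
      exact_mod_cast h1)
  rwa [← smul_neg, neg_sub] at this

lemma IsGamma.exists_mem_subdiff {f : E → EReal} (hf : IsGamma f) :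
    ∃ x v, v ∈ subdiff f x :=
  ⟨_, _, hf.mem_subdiff_prox one_pos 0⟩

lemma IsGamma.conj {f : E → EReal} (hf : IsGamma f) : IsGamma (conj f) := by
  refine ⟨⟨?_, conj_ne_bot hf.proper⟩, conj_isConvexFun f, conj_lowerSemicontinuous f⟩
  obtain ⟨x, v, hv⟩ := hf.exists_mem_subdiff
  exact ⟨v, lt_top_iff_ne_top.2 (mem_subdiff_conj hv).1⟩

/-- The Fenchel–Moreau inequality `f ≤ f**`. -/
lemma IsGamma.le_of_conj_conj_le {f : E → EReal} (hf : IsGamma f) {y : E} {c : ℝ}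
    (h : PrimalDual.conj (PrimalDual.conj f) y ≤ c) : f y ≤ c := by
  -- Proximal points replace Hahn–Banach separation. If `f > c` near `y`, the subgradient at `p =
  -- prox t f y` and `f** y ≤ c` give `f p + ‖y - p‖ ^ 2 / t ≤ c`. Hence `p` is outside the ball of
  -- radius `r`, while the cone minorant confines it to radius `t * K = r / 2`.
  by_contra hcon
  push Not at hcon
  obtain ⟨r, hr, hball⟩ := Metric.eventually_nhds_iff.1 (hf.lsc y c hcon)
  obtain ⟨c₀, d, hd, hcone⟩ := hf.exists_cone_minorant y
  set K := |c - c₀| / r + d + 1 with hK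
  have hKp : 0 < K := by positivity
  set t := r / (2 * K) with ht
  have htp : 0 < t := by positivity
  have hp := hf.mem_subdiff_prox htp y
  set p := prox t f y
  obtain ⟨a, ha, -⟩ := mem_subdiff_iff.1 hp
  have h1 := conj_le_coe_iff.1 h _ _ (conj_eq_of_mem_subdiff ha hp).le
  have h2 : ‖y - p‖ ^ 2 ≤ t * (c - a) := by
    have e : inner ℝ y (t⁻¹ • (y - p)) - (inner ℝ (t⁻¹ • (y - p)) p - a) =
        t⁻¹ * ‖y - p‖ ^ 2 + a := by
      rw [real_inner_comm, inner_smul_left, inner_smul_left, ← real_inner_self_eq_norm_sq,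
        inner_sub_right (y - p) y p]
      simp only [conj_trivial]
      ring
    rw [e] at h1
    have : t⁻¹ * ‖y - p‖ ^ 2 ≤ c - a := by linarith
    rwa [inv_mul_le_iff₀ htp] at this
  have hac : a ≤ c := by nlinarith [sq_nonneg ‖y - p‖]
  have hD : r ≤ ‖y - p‖ := by
    by_contra hlt
    push Not at hlt
    have : (c : EReal) < f p := hball (by rwa [dist_eq_norm, norm_sub_rev] : dist p y < r)
    rw [ha] at this
    exact absurd hac (not_le.2 (by exact_mod_cast this))
  have h3 := hcone p a ha.le
  rw [norm_sub_rev] at h3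
  have hD0 : 0 < ‖y - p‖ := hr.trans_le hD
  have h4 : c - a ≤ K * ‖y - p‖ := by
    have h5 : |c - c₀| ≤ |c - c₀| / r * ‖y - p‖ := by
      rw [div_mul_eq_mul_div, le_div_iff₀ hr]
      exact mul_le_mul_of_nonneg_left hD (abs_nonneg _)
    have := le_abs_self (c - c₀)
    rw [hK]
    nlinarith
  have h6 : ‖y - p‖ * ‖y - p‖ ≤ (r / 2) * ‖y - p‖ := by
    calc ‖y - p‖ * ‖y - p‖ = ‖y - p‖ ^ 2 := (sq _).symm
      _ ≤ t * (K * ‖y - p‖) := h2.trans (mul_le_mul_of_nonneg_left h4 htp.le)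
      _ = _ := by rw [ht]; field_simp
  have := le_of_mul_le_mul_right h6 hD0
  linarith

/-- Converse of `mem_subdiff_conj`; this is where Fenchel–Moreau enters, through the bound `f y ≤
⟨y, v⟩ - f* v`. -/
lemma IsGamma.mem_subdiff_of_mem_subdiff_conj {f : E → EReal} (hf : IsGamma f) {y v : E}
    (hy : y ∈ subdiff (PrimalDual.conj f) v) : v ∈ subdiff f y := by
  obtain ⟨a, ha, -⟩ := mem_subdiff_iff.1 hy
  have h1 := hf.le_of_conj_conj_le (conj_eq_of_mem_subdiff ha hy).le
  have h2 : ∀ (x : E) (b : ℝ), f x ≤ b → inner ℝ v x - a ≤ b := fun x b hb => by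
    have := conj_le_coe_iff.1 ha.le x b hb
    linarith
  refine mem_subdiff_iff.2 ⟨inner ℝ y v - a, le_antisymm h1 ?_, fun x b hb => ?_⟩
  · refine EReal.le_of_forall_lt_iff_le.1 fun b hb => ?_
    have := h2 y b hb.le
    rw [real_inner_comm]
    exact_mod_cast this
  · have := h2 x b hb
    rw [inner_sub_right, real_inner_comm]
    linarith

end Complete

/-! ### Smooth convex functions, and smoothness obtained from strong convexity of the conjugate. -/

/-- `φ` is a finite convex function whose subdifferential contains the Lipschitzian selection `T`;
then `T` is the gradient of `φ`. -/
structure IsSmoothConvex (φ : E → ℝ) (T : E → E) : Prop where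
  add_le : ∀ x y, φ x + inner ℝ (T x) (y - x) ≤ φ y
  lipschitz : ∃ C, ∀ x y, ‖T x - T y‖ ≤ C * ‖x - y‖

namespace IsSmoothConvex

variable {φ ψ : E → ℝ} {T U : E → E}

/-- Descent lemma without integration: the subgradient inequality based at `y`, plus the Lipschitz
bound. The constant is not the sharp `C / 2`, but any constant serves. -/
lemma exists_le (h : IsSmoothConvex φ T) :
    ∃ C, ∀ x y, φ y ≤ φ x + inner ℝ (T x) (y - x) + C * ‖y - x‖ ^ 2 := by
  obtain ⟨C, hC⟩ := h.lipschitz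
  refine ⟨C, fun x y => ?_⟩
  have h1 := h.add_le y x
  have h2 : inner ℝ (T y - T x) (y - x) ≤ C * ‖y - x‖ ^ 2 := by
    refine (real_inner_le_norm _ _).trans ?_
    rw [sq, ← mul_assoc]
    exact mul_le_mul_of_nonneg_right (hC y x) (norm_nonneg _)
  rw [inner_sub_left] at h2
  rw [← neg_sub y x, inner_neg_right] at h1
  linarith

/-- The first-order remainder lies between `0` and `C * ‖y - x‖ ^ 2`. This identifies `T` with
`gradient`, as the dual update requires for `l i*`. -/
lemma hasGradientAt [CompleteSpace E] (h : IsSmoothConvex φ T) (x : E) :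
    HasGradientAt φ (T x) x := by
  obtain ⟨C, hC⟩ := h.exists_le
  rw [hasGradientAt_iff_isLittleO]
  have h1 : (fun y : E => φ y - φ x - inner ℝ (T x) (y - x)) =O[nhds x]
      fun y => ‖y - x‖ ^ 2 := by
    refine Asymptotics.IsBigO.of_bound C (Filter.Eventually.of_forall fun y => ?_)
    have h2 := h.add_le x y
    have h3 := hC x y
    rw [Real.norm_of_nonneg (by linarith), Real.norm_of_nonneg (by positivity)]
    linarith
  refine h1.trans_isLittleO ?_
  have h4 : (fun y : E => ‖y - x‖ ^ 2) =o[nhds x] fun y => ‖y - x‖ ^ 1 := by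
    have := Asymptotics.isLittleO_pow_pow (𝕜 := ℝ) (show 1 < 2 by norm_num)
    exact this.comp_tendsto (k := fun y : E => ‖y - x‖) (l' := nhds x) (by
      have : Continuous fun y : E => ‖y - x‖ := by fun_prop
      simpa using this.tendsto x)
  simpa using h4

lemma continuous [CompleteSpace E] (h : IsSmoothConvex φ T) : Continuous φ :=
  continuous_iff_continuousAt.2 fun x => (h.hasGradientAt x).continuousAt

lemma strongConvexEpi (h : IsSmoothConvex φ T) :
    StrongConvexEpi 0 fun x => (φ x : EReal) := by
  intro x y a b t hx hy h0 h1
  simp only [EReal.coe_le_coe_iff] at hx hy ⊢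
  have h2 := h.add_le ((1 - t) • x + t • y) x
  have h3 := h.add_le ((1 - t) • x + t • y) y
  have e1 : x - ((1 - t) • x + t • y) = (-t) • (y - x) := by module
  have e2 : y - ((1 - t) • x + t • y) = (1 - t) • (y - x) := by module
  rw [e1, inner_smul_right] at h2
  rw [e2, inner_smul_right] at h3
  nlinarith

lemma mem_subdiff (h : IsSmoothConvex φ T) (x : E) :
    T x ∈ subdiff (fun x => (φ x : EReal)) x :=
  mem_subdiff_iff.2 ⟨φ x, rfl, fun y b hb => (h.add_le x y).trans (by exact_mod_cast hb)⟩

lemma add (h : IsSmoothConvex φ T) (h' : IsSmoothConvex ψ U) :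
    IsSmoothConvex (fun x => φ x + ψ x) (fun x => T x + U x) := by
  refine ⟨fun x y => ?_, ?_⟩
  · rw [inner_add_left]
    linarith [h.add_le x y, h'.add_le x y]
  · obtain ⟨C, hC⟩ := h.lipschitz
    obtain ⟨D, hD⟩ := h'.lipschitz
    refine ⟨C + D, fun x y => ?_⟩
    rw [add_sub_add_comm, add_mul]
    exact (norm_add_le _ _).trans (add_le_add (hC x y) (hD x y))

lemma inner_left (u : E) : IsSmoothConvex (fun x => inner ℝ u x) (fun _ => u) :=
  ⟨fun x y => by rw [inner_sub_right]; linarith, 0, fun x y => by simp⟩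

lemma sum {ι : Type*} (s : Finset ι) {φ : ι → E → ℝ} {T : ι → E → E}
    (h : ∀ i, IsSmoothConvex (φ i) (T i)) :
    IsSmoothConvex (fun x => ∑ i ∈ s, φ i x) (fun x => ∑ i ∈ s, T i x) := by
  classical
  induction s using Finset.induction_on with
  | empty => simpa using inner_left (0 : E)
  | insert i s hi ih =>
    simp only [Finset.sum_insert hi]
    exact (h i).add ih

lemma comp_affine {F : Type*} [NormedAddCommGroup F] [InnerProductSpace ℝ F] [CompleteSpace E]
    [CompleteSpace F] (h : IsSmoothConvex φ T) (A : F →L[ℝ] E) (r : E) :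
    IsSmoothConvex (fun x => φ (A x - r))
      (fun x => ContinuousLinearMap.adjoint A (T (A x - r))) := by
  refine ⟨fun x y => ?_, ?_⟩
  · have := h.add_le (A x - r) (A y - r)
    rwa [sub_sub_sub_cancel_right, ← map_sub, ← ContinuousLinearMap.adjoint_inner_left] at this
  · obtain ⟨C, hC⟩ := h.lipschitz
    refine ⟨‖ContinuousLinearMap.adjoint A‖ * (|C| * ‖A‖), fun x y => ?_⟩
    rw [← map_sub, mul_assoc]
    refine (ContinuousLinearMap.le_opNorm _ _).trans ?_
    gcongr
    have h1 := hC (A x - r) (A y - r)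
    rw [sub_sub_sub_cancel_right, ← map_sub] at h1
    calc ‖T (A x - r) - T (A y - r)‖ ≤ C * ‖A (x - y)‖ := h1
      _ ≤ |C| * (‖A‖ * ‖x - y‖) := by
        gcongr
        · exact le_abs_self C
        · exact A.le_opNorm _
      _ = _ := by ring

end IsSmoothConvex

/-- A differentiable convex function with Lipschitzian gradient. -/
lemma isSmoothConvex_gradient [CompleteSpace E] {h : E → ℝ} (hconv : ConvexOn ℝ Set.univ h)
    (hdiff : Differentiable ℝ h) {η : ℝ}
    (hlip : ∀ x y : E, ‖gradient h x - gradient h y‖ ≤ η * ‖x - y‖) :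
    IsSmoothConvex h (gradient h) := by
  refine ⟨fun x y => ?_, η, hlip⟩
  set A : ℝ →ᵃ[ℝ] E := AffineMap.lineMap x y
  have hc : ConvexOn ℝ Set.univ (h ∘ A) := by simpa using hconv.comp_affineMap A
  have hd : HasDerivAt (h ∘ A) (inner ℝ (gradient h x) (y - x)) 0 := by
    have h1 : HasDerivAt A (y - x) 0 := AffineMap.hasDerivAt_lineMap
    have h2 : HasFDerivAt h (fderiv ℝ h x) (A 0) := by
      simpa [A] using (hdiff x).hasFDerivAt
    rw [← InnerProductSpace.toDual_apply_apply (𝕜 := ℝ), toDual_gradient]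
    exact h2.comp_hasDerivAt (0 : ℝ) h1
  have := hc.le_slope_of_hasDerivAt (Set.mem_univ 0) (Set.mem_univ 1) one_pos hd
  simp only [slope_def_field, Function.comp, A, AffineMap.lineMap_apply_one,
    AffineMap.lineMap_apply_zero, sub_zero, div_one] at this
  linarith

/-- Turns strong monotonicity of a subdifferential into a Lipschitz bound for a selection of its
inverse. -/
lemma norm_le_inv_mul_of_mul_sq_le_inner {δ : ℝ} (hδ : 0 < δ) {p q : E}
    (h : δ * ‖p‖ ^ 2 ≤ inner ℝ q p) : ‖p‖ ≤ δ⁻¹ * ‖q‖ := by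
  rcases (norm_nonneg p).eq_or_lt' with h0 | h0
  · rw [h0]
    positivity
  · rw [le_inv_mul_iff₀ hδ]
    have := h.trans (real_inner_le_norm q p)
    rw [sq, ← mul_assoc] at this
    exact le_of_mul_le_mul_right this h0

/-- The conjugate of a `β`-strongly convex function is finite and smooth, with `β⁻¹`-Lipschitzian
gradient. -/
lemma IsGamma.exists_conj_eq_smooth [CompleteSpace E] {l : E → EReal} (hl : IsGamma l) {β : ℝ}
    (hβ : 0 < β) (hs : StrongConvexEpi β l) :
    ∃ (ψ : E → ℝ) (W : E → E), (∀ u, PrimalDual.conj l u = (ψ u : EReal)) ∧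
      (∀ u, u ∈ subdiff l (W u)) ∧ IsSmoothConvex ψ W ∧
      ∀ u u', ‖W u - W u'‖ ≤ β⁻¹ * ‖u - u'‖ := by
  -- `w` minimizes `l - ⟨u, ·⟩`; the selection `W` is the gradient of `l*`.
  have hex : ∀ u : E, ∃ w, u ∈ subdiff l w := by
    intro u
    have hF := hs.add_coe (IsSmoothConvex.inner_left (-u)).strongConvexEpi
    rw [add_zero] at hF
    obtain ⟨w, a, ha, hmin⟩ := hF.exists_minimizer hβ
      (lowerSemicontinuous_add_coe hl.lsc (by fun_prop)) (isProper_add_coe hl.proper _)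
    have ha' : l w = ((a + inner ℝ u w : ℝ) : EReal) := by
      refine le_antisymm ?_ (not_lt.1 fun hlt => ?_)
      · have := add_coe_le_coe_iff.1 ha.le
        simpa using this
      · obtain ⟨c, hc1, hc2⟩ := EReal.lt_iff_exists_real_btwn.1 hlt
        have h1 := hmin w (c - inner ℝ u w) (by
          rw [add_coe_le_coe_iff]
          simpa using hc1.le)
        have h2 : c < a + inner ℝ u w := by exact_mod_cast hc2
        linarith
    refine ⟨w, mem_subdiff_iff.2 ⟨_, ha', fun y b hb => ?_⟩⟩
    have := hmin y (b - inner ℝ u y) (by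
      rw [add_coe_le_coe_iff]
      simpa using hb)
    rw [inner_sub_right]
    linarith
  choose W hW using hex
  have hfin : ∀ u, ∃ c : ℝ, PrimalDual.conj l u = c := fun u => by
    obtain ⟨a, ha, -⟩ := mem_subdiff_iff.1 (hW u)
    exact ⟨_, conj_eq_of_mem_subdiff ha (hW u)⟩
  choose ψ hψ using hfin
  have hLip : ∀ u u', ‖W u - W u'‖ ≤ β⁻¹ * ‖u - u'‖ := fun u u' =>
    norm_le_inv_mul_of_mul_sq_le_inner hβ (hs.inner_ge_of_mem_subdiff (hW u) (hW u'))
  refine ⟨ψ, W, hψ, hW, ⟨fun u u' => ?_, _, hLip⟩, hLip⟩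
  have := (mem_subdiff_conj (hW u)).2.2 u'
  rw [hψ, hψ] at this
  exact_mod_cast this

/-- If `g* + l*` and `l` are strongly convex, then `g □ l` is finite and smooth, and the infimal
convolution is attained. -/
lemma IsGamma.exists_infConv_eq_smooth [CompleteSpace E] {g l : E → EReal} (hg : IsGamma g)
    {δ : ℝ} (hδ : 0 < δ)
    (hgl : StrongConvexEpi δ fun u => PrimalDual.conj g u + PrimalDual.conj l u)
    {ψ : E → ℝ} {W : E → E} (hψ : ∀ u, PrimalDual.conj l u = (ψ u : EReal))
    (hW : ∀ u, u ∈ subdiff l (W u)) (hsm : IsSmoothConvex ψ W) :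
    ∃ (φ : E → ℝ) (T : E → E), (∀ x, infConv g l x = (φ x : EReal)) ∧ IsSmoothConvex φ T ∧
      (∀ x, T x ∈ subdiff g (x - W (T x))) ∧
      ∀ x, PrimalDual.conj g (T x) = ((inner ℝ (T x) x - φ x - ψ (T x) : ℝ) : EReal) := by
  -- `v` minimizes `g* + l* - ⟨x, ·⟩`. Optimality reads `x - W v ∈ ∂g*(v)`, and inverting `∂g*`
  -- splits `x` into `x - W v` and `W v`, points where `g` and `l` share the subgradient `v`. The
  -- infimal convolution is attained at this splitting.
  have hex : ∀ x : E, ∃ v, v ∈ subdiff g (x - W v) := by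
    intro x
    have hS : IsSmoothConvex (fun u => ψ u + inner ℝ (-x) u) (fun u => W u + -x) :=
      hsm.add (IsSmoothConvex.inner_left (-x))
    have hF := hgl.add_coe (IsSmoothConvex.inner_left (-x)).strongConvexEpi
    have e : (fun u => PrimalDual.conj g u + PrimalDual.conj l u + ((inner ℝ (-x) u : ℝ) : EReal)) =
        fun u => PrimalDual.conj g u + ((ψ u + inner ℝ (-x) u : ℝ) : EReal) := by
      funext u
      rw [hψ, EReal.coe_add, add_assoc]
    rw [add_zero, e] at hF
    obtain ⟨v, a, ha, hmin⟩ := hF.exists_minimizer hδ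
      (lowerSemicontinuous_add_coe hg.conj.lsc hS.continuous) (isProper_add_coe hg.conj.proper _)
    have hv := add_coe_le_coe_iff.1 ha.le
    obtain ⟨k, hv'⟩ : ∃ k : ℝ, PrimalDual.conj g v = k :=
      ⟨_, (EReal.coe_toReal (hv.trans_lt (EReal.coe_lt_top _)).ne (hg.conj.proper.2 v)).symm⟩
    obtain ⟨C, hC⟩ := hS.exists_le
    have h1 := hg.conj.convex.strongConvexEpi.subgradient_of_isMin hv' (hC v) (fun y b hb => by
      have h2 := hmin y (b + (ψ y + inner ℝ (-x) y)) (by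
        rw [add_coe_le_coe_iff]
        simpa using hb)
      simp only [hv'] at ha
      have h3 : k + (ψ v + inner ℝ (-x) v) = a := by exact_mod_cast ha
      linarith)
    refine ⟨v, hg.mem_subdiff_of_mem_subdiff_conj ?_⟩
    convert h1 using 1
    abel
  choose T hT using hex
  have hgfin : ∀ x, ∃ a : ℝ, g (x - W (T x)) = a := fun x =>
    (mem_subdiff_iff.1 (hT x)).imp fun a ha => ha.1
  have hlfin : ∀ u, ∃ b : ℝ, l (W u) = b := fun u =>
    (mem_subdiff_iff.1 (hW u)).imp fun a ha => ha.1
  choose a ha using hgfin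
  choose b hb using hlfin
  have hφ : ∀ x, infConv g l x = ((a x + b (T x) : ℝ) : EReal) := by
    intro x
    refine le_antisymm (iInf_le_of_le (x - W (T x)) ?_) (le_iInf fun y => ?_)
    · rw [sub_sub_cancel, ha, hb]
      norm_cast
    · have h1 := (hT x).2.2 y
      have h2 := (hW (T x)).2.2 (x - y)
      refine le_trans (le_of_eq ?_) (add_le_add h1 h2)
      rw [ha, hb]
      norm_cast
      have : x - y - W (T x) = -(y - (x - W (T x))) := by abel
      rw [this, inner_neg_right]
      ring
  have hψT : ∀ u, ψ u = inner ℝ u (W u) - b u := fun u => by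
    have := conj_eq_of_mem_subdiff (hb u) (hW u)
    rw [hψ] at this
    exact_mod_cast this
  have hmem : ∀ x, x ∈ subdiff (fun u => PrimalDual.conj g u + PrimalDual.conj l u) (T x) := by
    intro x
    have := mem_subdiff_add (mem_subdiff_conj (hT x)) (mem_subdiff_conj (hW (T x)))
    rwa [sub_add_cancel] at this
  refine ⟨fun x => a x + b (T x), T, hφ, ⟨fun x y => ?_, δ⁻¹, fun x y => ?_⟩, hT, fun x => ?_⟩
  · have h1 := (hT x).2.2 (y - W (T y))
    have h2 := (hW (T x)).2.2 (W (T y))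
    rw [ha, ha] at h1
    rw [hb, hb] at h2
    have h1' : a x + inner ℝ (T x) (y - W (T y) - (x - W (T x))) ≤ a y := by exact_mod_cast h1
    have h2' : b (T x) + inner ℝ (T x) (W (T y) - W (T x)) ≤ b (T y) := by exact_mod_cast h2
    simp only [inner_sub_right] at h1' h2' ⊢
    linarith
  · exact norm_le_inv_mul_of_mul_sq_le_inner hδ (hgl.inner_ge_of_mem_subdiff (hmem x) (hmem y))
  · rw [conj_eq_of_mem_subdiff (ha x) (hT x), hψT, inner_sub_right]
    congr 1
    ring

end Conjugate

lemma coe_sum_ereal {ι : Type*} (s : Finset ι) (c : ι → ℝ) :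
    ((∑ i ∈ s, c i : ℝ) : EReal) = ∑ i ∈ s, (c i : EReal) := by
  classical
  induction s using Finset.induction_on with
  | empty => simp
  | insert i s hi ih => rw [Finset.sum_insert hi, Finset.sum_insert hi, EReal.coe_add, ih]

/-! ### Weak duality with quadratic growth, and existence of a primal-dual pair. -/

section Duality

variable {H : Type*} [NormedAddCommGroup H] [InnerProductSpace ℝ H] [CompleteSpace H]
  {m : ℕ} {G : Fin m → Type*} [∀ i, NormedAddCommGroup (G i)]
  [∀ i, InnerProductSpace ℝ (G i)] [∀ i, CompleteSpace (G i)]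

/-- Fenchel–Young: a real lower bound for the conjugate. -/
lemma coe_inner_sub_le_conj {E : Type*} [NormedAddCommGroup E] [InnerProductSpace ℝ E]
    {f : E → EReal} {x : E} {a : ℝ} (ha : f x = a) (u : E) :
    ((inner ℝ u x - a : ℝ) : EReal) ≤ conj f u :=
  EReal.le_of_forall_lt_iff_le.1 fun c hc => by
    exact_mod_cast conj_le_coe_iff.1 hc.le x a ha.le

/-- Weak duality at a primal point, with quadratic growth in the dual variable. -/
lemma dualObj_le {z : H} {f : H → EReal} {h : H → ℝ} {r : ∀ i, G i} {g l : ∀ i, G i → EReal}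
    {L : ∀ i, H →L[ℝ] G i} {δ : Fin m → ℝ}
    (hgl : ∀ i, StrongConvexEpi (δ i) fun u => conj (g i) u + conj (l i) u)
    {x : H} {a : ℝ} (ha : f x = a) {v : ∀ i, G i} {c : Fin m → ℝ}
    (hc : ∀ i, conj (g i) (v i) + conj (l i) (v i) = c i)
    (hv : ∀ i, L i x - r i ∈ subdiff (fun u => conj (g i) u + conj (l i) u) (v i))
    (w : ∀ i, G i) :
    dualObj z f h r g l L w ≤
      ((a + h x - inner ℝ x z - ∑ i, (c i - inner ℝ (L i x - r i) (v i)) -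
        ∑ i, δ i / 2 * ‖w i - v i‖ ^ 2 : ℝ) : EReal) := by
  have h1 : ((inner ℝ (z - ∑ i, ContinuousLinearMap.adjoint (L i) (w i)) x - a - h x : ℝ) : EReal) ≤
      infConv (conj f) (conj fun x => (h x : EReal))
        (z - ∑ i, ContinuousLinearMap.adjoint (L i) (w i)) := by
    refine le_iInf fun p => ?_
    refine le_trans (le_of_eq ?_) (add_le_add (coe_inner_sub_le_conj ha p)
      (coe_inner_sub_le_conj (f := fun x => (h x : EReal)) (x := x) rfl _))
    norm_cast
    rw [inner_sub_left _ p]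
    ring
  have h2 : ∀ i, ((c i + inner ℝ (L i x - r i) (w i - v i) + δ i / 2 * ‖w i - v i‖ ^ 2 +
      inner ℝ (w i) (r i) : ℝ) : EReal) ≤
      conj (g i) (w i) + conj (l i) (w i) + ((inner ℝ (w i) (r i) : ℝ) : EReal) := by
    intro i
    rw [EReal.coe_add]
    refine add_le_add_left (EReal.le_of_forall_lt_iff_le.1 fun b hb => ?_) _
    exact_mod_cast (hgl i).add_le_of_mem_subdiff (hc i) (hv i) hb.le
  have h3 := Finset.sum_le_sum fun i (_ : i ∈ Finset.univ) => h2 i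
  rw [← coe_sum_ereal] at h3
  refine (EReal.sub_le_sub (EReal.neg_le_neg_iff.2 h1) h3).trans (le_of_eq ?_)
  norm_cast
  rw [inner_sub_left, sum_inner]
  simp only [ContinuousLinearMap.adjoint_inner_left]
  have e : ∀ i, c i + inner ℝ (L i x - r i) (w i - v i) + δ i / 2 * ‖w i - v i‖ ^ 2 +
      inner ℝ (w i) (r i) = (c i - inner ℝ (L i x - r i) (v i)) + δ i / 2 * ‖w i - v i‖ ^ 2 +
      inner ℝ (w i) (L i x) := by
    intro i
    rw [inner_sub_right, inner_sub_left (L i x) (r i) (w i), real_inner_comm (w i) (L i x),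
      real_inner_comm (w i) (r i)]
    ring
  simp only [e, Finset.sum_add_distrib]
  rw [real_inner_comm]
  ring

/-- Existence of primal and dual solutions, optimality conditions, quadratic growth of both
objectives, and strong duality. Strong convexity of `g* + l*` makes `g □ l` finite everywhere, that
is `dom g + dom l` is the whole space, so that no qualification condition is needed. -/
lemma exists_primal_dual_solution
    (z : H) {f : H → EReal} (hf : IsGamma f) {h : H → ℝ}
    (hsm : IsSmoothConvex h (gradient h)) (r : ∀ i, G i) {g l : ∀ i, G i → EReal}
    (hg : ∀ i, IsGamma (g i)) (L : ∀ i, H →L[ℝ] G i)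
    {γ : ℝ} (hγ : 0 < γ) (hfh : StrongConvexEpi γ fun x => f x + (h x : EReal))
    {δ : Fin m → ℝ} (hδ : ∀ i, 0 < δ i)
    (hgl : ∀ i, StrongConvexEpi (δ i) fun u => conj (g i) u + conj (l i) u)
    {ψ : ∀ i, G i → ℝ} {W : ∀ i, G i → G i} (hψ : ∀ i u, conj (l i) u = (ψ i u : EReal))
    (hW : ∀ i u, u ∈ subdiff (l i) (W i u)) (hWs : ∀ i, IsSmoothConvex (ψ i) (W i)) :
    ∃ (xbar : H) (vbar : ∀ i, G i) (P : ℝ),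
      primalObj z f h r g l L xbar = P ∧
      (∀ (x : H) (b : ℝ), primalObj z f h r g l L x ≤ b → P + γ / 2 * ‖x - xbar‖ ^ 2 ≤ b) ∧
      dualObj z f h r g l L vbar = P ∧
      (∀ v, dualObj z f h r g l L v ≤
        ((P - ∑ i, δ i / 2 * ‖v i - vbar i‖ ^ 2 : ℝ) : EReal)) ∧
      z - ∑ i, ContinuousLinearMap.adjoint (L i) (vbar i) - gradient h xbar ∈ subdiff f xbar ∧
      ∀ i, vbar i ∈ subdiff (g i) (L i xbar - r i - W i (vbar i)) := by
  choose φ T hφ hT hTg hgT using fun i =>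
    (hg i).exists_infConv_eq_smooth (hδ i) (hgl i) (hψ i) (hW i) (hWs i)
  have hR : IsSmoothConvex (fun x => ∑ i, φ i (L i x - r i) + inner ℝ (-z) x)
      (fun x => ∑ i, ContinuousLinearMap.adjoint (L i) (T i (L i x - r i)) + -z) :=
    (IsSmoothConvex.sum Finset.univ fun i => (hT i).comp_affine (L i) (r i)).add
      (IsSmoothConvex.inner_left (-z))
  have hS := hsm.add hR
  have hobj : ∀ x, primalObj z f h r g l L x =
      f x + (h x : EReal) + ((∑ i, φ i (L i x - r i) + inner ℝ (-z) x : ℝ) : EReal) := by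
    intro x
    unfold primalObj
    simp only [hφ, ← coe_sum_ereal]
    rw [sub_eq_add_neg, ← EReal.coe_neg, inner_neg_left, real_inner_comm, EReal.coe_add]
    simp only [add_assoc, add_left_comm, add_comm]
  have hF := hfh.add_coe hR.strongConvexEpi
  rw [add_zero] at hF
  obtain ⟨x, P, hP, hmin⟩ := hF.exists_minimizer hγ
    (lowerSemicontinuous_add_coe (lowerSemicontinuous_add_coe hf.lsc hsm.continuous) hR.continuous)
    (isProper_add_coe (isProper_add_coe hf.proper _) _)
  have hfx : ∃ a : ℝ, f x = a := by
    have h1 := add_coe_le_coe_iff.1 (add_coe_le_coe_iff.1 hP.le)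
    exact ⟨_, (EReal.coe_toReal (h1.trans_lt (EReal.coe_lt_top _)).ne (hf.proper.2 x)).symm⟩
  obtain ⟨a, ha⟩ := hfx
  have hPa : P = a + h x + (∑ i, φ i (L i x - r i) + inner ℝ (-z) x) := by
    simp only [ha] at hP
    exact_mod_cast hP.symm
  -- The dual solution is read off from the gradients of `g i □ l i` at the primal solution.
  set v : ∀ i, G i := fun i => T i (L i x - r i) with hv
  obtain ⟨C, hC⟩ := hS.exists_le
  have hsub := hf.convex.strongConvexEpi.subgradient_of_isMin ha (hC x) (fun y b hb => by
    have := hmin y (b + h y + (∑ i, φ i (L i y - r i) + inner ℝ (-z) y)) (by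
      rw [add_coe_le_coe_iff, add_coe_le_coe_iff]
      simpa using hb)
    linarith)
  have hp : -(gradient h x + (∑ i, ContinuousLinearMap.adjoint (L i) (T i (L i x - r i)) + -z)) =
      z - ∑ i, ContinuousLinearMap.adjoint (L i) (v i) - gradient h x := by
    simp only [hv]
    abel
  rw [hp] at hsub
  have hmemT : ∀ i, L i x - r i ∈ subdiff (fun u => conj (g i) u + conj (l i) u) (v i) := by
    intro i
    have := mem_subdiff_add (mem_subdiff_conj (hTg i (L i x - r i)))
      (mem_subdiff_conj (hW i (T i (L i x - r i))))
    rwa [sub_add_cancel] at this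
  have hcv : ∀ i, conj (g i) (v i) + conj (l i) (v i) =
      ((inner ℝ (v i) (L i x - r i) - φ i (L i x - r i) : ℝ) : EReal) := by
    intro i
    rw [hgT, hψ]
    norm_cast
    ring
  have hdle : ∀ w, dualObj z f h r g l L w ≤
      ((P - ∑ i, δ i / 2 * ‖w i - v i‖ ^ 2 : ℝ) : EReal) := by
    intro w
    refine (dualObj_le hgl ha hcv hmemT w).trans (le_of_eq ?_)
    congr 1
    have e : ∀ i, inner ℝ (v i) (L i x - r i) - φ i (L i x - r i) -
        inner ℝ (L i x - r i) (v i) = -φ i (L i x - r i) := by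
      intro i
      rw [real_inner_comm]
      ring
    simp only [e, Finset.sum_neg_distrib]
    rw [hPa, inner_neg_left, real_inner_comm]
    ring
  have hdge : (P : EReal) ≤ dualObj z f h r g l L v := by
    have h1 : infConv (conj f) (conj fun x => (h x : EReal))
        (z - ∑ i, ContinuousLinearMap.adjoint (L i) (v i)) ≤
        ((inner ℝ (z - ∑ i, ContinuousLinearMap.adjoint (L i) (v i)) x - a - h x : ℝ) : EReal) := by
      -- At this splitting both Fenchel–Young inequalities are equalities at `x`.
      refine iInf_le_of_le (z - ∑ i, ContinuousLinearMap.adjoint (L i) (v i) - gradient h x)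
        (le_of_eq ?_)
      rw [sub_sub_cancel, conj_eq_of_mem_subdiff ha hsub,
        conj_eq_of_mem_subdiff (f := fun x => (h x : EReal)) rfl (hsm.mem_subdiff x)]
      norm_cast
      rw [inner_sub_left _ (gradient h x)]
      ring
    refine le_trans (le_of_eq ?_) (EReal.sub_le_sub (EReal.neg_le_neg_iff.2 h1) le_rfl)
    simp only [hcv]
    have e : ∀ i, ((inner ℝ (v i) (L i x - r i) - φ i (L i x - r i) : ℝ) : EReal) +
        ((inner ℝ (v i) (r i) : ℝ) : EReal) =
        ((inner ℝ (v i) (L i x) - φ i (L i x - r i) : ℝ) : EReal) := by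
      intro i
      norm_cast
      rw [inner_sub_right]
      ring
    simp only [e, ← coe_sum_ereal]
    norm_cast
    rw [hPa, inner_sub_left, sum_inner, inner_neg_left]
    simp only [ContinuousLinearMap.adjoint_inner_left, Finset.sum_sub_distrib]
    ring
  have hPx : primalObj z f h r g l L x = P := (hobj x).trans hP
  refine ⟨x, v, P, hPx, fun y b hb => ?_, le_antisymm ?_ hdge, hdle, hsub,
    fun i => hTg i (L i x - r i)⟩
  · have h0 : (0 : H) ∈ subdiff (fun x => f x + (h x : EReal) +
        ((∑ i, φ i (L i x - r i) + inner ℝ (-z) x : ℝ) : EReal)) x :=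
      mem_subdiff_iff.2 ⟨P, hP, fun y b hb => by simpa using hmin y b hb⟩
    rw [hobj] at hb
    simpa using hF.add_le_of_mem_subdiff hP h0 hb
  · simpa using hdle v

end Duality

/-! ### One-step estimates and the linear convergence rate. -/

section Rate

/-- One forward-backward step for a strongly convex sum. -/
lemma forward_backward_step {E : Type*} [NormedAddCommGroup E] [InnerProductSpace ℝ E]
    [CompleteSpace E] {f : E → EReal} (hf : IsGamma f) {φ : E → ℝ} {C : E → E}
    (hC : IsSmoothConvex φ C) {η : ℝ} (hη : 0 < η) (hlip : ∀ x y, ‖C x - C y‖ ≤ η * ‖x - y‖)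
    {γ : ℝ} (hγ : 0 < γ) (hs : StrongConvexEpi γ fun x => f x + (φ x : EReal))
    {μ τ : ℝ} (hμ : 0 < μ) (hμγ : μ ≤ γ ^ 2 / η ^ 2) (hτ : τ = μ / (2 * γ))
    {x p xbar q qbar : E} (hp : p = prox τ f (x - τ • (q + C x)))
    (hbar : -qbar - C xbar ∈ subdiff f xbar) :
    γ * (1 + μ / 2) * ‖p - xbar‖ ^ 2 + γ / 2 * ‖p - x‖ ^ 2 ≤
      γ * ‖x - xbar‖ ^ 2 - μ * inner ℝ (q - qbar) (p - xbar) := by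
  have hτ0 : 0 < τ := by rw [hτ]; positivity
  have h1 := hf.mem_subdiff_prox hτ0 (x - τ • (q + C x))
  rw [← hp] at h1
  -- Only the sum is strongly convex, so `C p` is added to the proximal subgradient; the mismatch `C
  -- x - C p` is controlled by `η`.
  have h2 := hs.inner_ge_of_mem_subdiff (mem_subdiff_add h1 (hC.mem_subdiff p))
    (mem_subdiff_add hbar (hC.mem_subdiff xbar))
  have e : τ⁻¹ • (x - τ • (q + C x) - p) + C p - (-qbar - C xbar + C xbar) =
      τ⁻¹ • (x - p) - (q - qbar) - (C x - C p) := by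
    rw [sub_right_comm, smul_sub, inv_smul_smul₀ hτ0.ne']
    abel
  rw [e, inner_sub_left, inner_sub_left, inner_smul_left] at h2
  simp only [conj_trivial] at h2
  have h3 : inner ℝ (x - p) (p - xbar) =
      (‖x - xbar‖ ^ 2 - ‖p - xbar‖ ^ 2 - ‖p - x‖ ^ 2) / 2 := by
    have : x - xbar = (x - p) + (p - xbar) := by abel
    rw [this, norm_add_sq_real, norm_sub_rev p x]
    ring
  have h4 : -(η * ‖p - x‖ * ‖p - xbar‖) ≤ inner ℝ (C x - C p) (p - xbar) := by
    have h5 := (abs_le.1 (abs_real_inner_le_norm (C x - C p) (p - xbar))).1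
    have h6 := hlip x p
    rw [norm_sub_rev x p] at h6
    have := mul_le_mul_of_nonneg_right h6 (norm_nonneg (p - xbar))
    linarith
  have h7 : μ * τ⁻¹ = 2 * γ := by
    rw [hτ]
    field_simp
  rw [h3] at h2
  set A := ‖p - xbar‖
  set D := ‖p - x‖
  have h8 : μ * (γ * A ^ 2) ≤ γ * (‖x - xbar‖ ^ 2 - A ^ 2 - D ^ 2) -
      μ * inner ℝ (q - qbar) (p - xbar) + μ * (η * D * A) := by
    have := mul_le_mul_of_nonneg_left (h2.trans (sub_le_sub_left h4 _)) hμ.le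
    refine this.trans (le_of_eq ?_)
    linear_combination (‖x - xbar‖ ^ 2 - A ^ 2 - D ^ 2) / 2 * h7
  have h9 : μ * η ^ 2 ≤ γ ^ 2 := (le_div_iff₀ (by positivity)).1 hμγ
  -- Young's inequality weighted to use half of each available square; this is where `μ ≤ γ ^ 2 / η
  -- ^ 2` is needed.
  have h10 : μ * (η * D * A) ≤ μ * γ / 2 * A ^ 2 + γ / 2 * D ^ 2 := by
    have h11 : μ * (η * D * A) ≤ μ * γ / 2 * A ^ 2 + μ * η ^ 2 / (2 * γ) * D ^ 2 := by
      have h13 : 0 ≤ μ * (γ * A - η * D) ^ 2 / (2 * γ) := by positivity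
      have : μ * (γ * A - η * D) ^ 2 / (2 * γ) =
          μ * γ / 2 * A ^ 2 + μ * η ^ 2 / (2 * γ) * D ^ 2 - μ * (η * D * A) := by
        field_simp
        ring
      linarith
    have h12 : μ * η ^ 2 / (2 * γ) ≤ γ / 2 := by
      rw [div_le_iff₀ (by positivity)]
      linarith
    have := mul_le_mul_of_nonneg_right h12 (sq_nonneg D)
    linarith
  linarith

variable {H : Type*} [NormedAddCommGroup H] [InnerProductSpace ℝ H]
  {m : ℕ} {G : Fin m → Type*} [∀ i, NormedAddCommGroup (G i)]
  [∀ i, InnerProductSpace ℝ (G i)]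

/-- Weighted Young inequality for the coupling term. -/
lemma coupling_le (L : ∀ i, H →L[ℝ] G i) {γ μ α : ℝ} {δ : Fin m → ℝ} (hδ : ∀ i, 0 < δ i)
    (hα : 0 < α) (hμ : 0 < μ) (hK : μ ^ 2 * ∑ i, ‖L i‖ ^ 2 / δ i ≤ γ) (d : H) (w : ∀ i, G i) :
    μ * ∑ i, inner ℝ (L i d) (w i) ≤
      α * (γ / 2) * ‖d‖ ^ 2 + 1 / (2 * α) * ∑ i, δ i * ‖w i‖ ^ 2 := by
  have h1 : ∀ i, μ * inner ℝ (L i d) (w i) ≤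
      α / 2 * ‖d‖ ^ 2 * (μ ^ 2 * (‖L i‖ ^ 2 / δ i)) + 1 / (2 * α) * (δ i * ‖w i‖ ^ 2) := by
    intro i
    have hi := hδ i
    have h2 : inner ℝ (L i d) (w i) ≤ ‖L i‖ * ‖d‖ * ‖w i‖ :=
      (real_inner_le_norm _ _).trans
        (mul_le_mul_of_nonneg_right ((L i).le_opNorm d) (norm_nonneg _))
    have h3 : 0 ≤ (α * μ * ‖L i‖ * ‖d‖ - δ i * ‖w i‖) ^ 2 / (2 * α * δ i) := by positivity
    have h4 : (α * μ * ‖L i‖ * ‖d‖ - δ i * ‖w i‖) ^ 2 / (2 * α * δ i) =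
        α / 2 * ‖d‖ ^ 2 * (μ ^ 2 * (‖L i‖ ^ 2 / δ i)) + 1 / (2 * α) * (δ i * ‖w i‖ ^ 2) -
          μ * (‖L i‖ * ‖d‖ * ‖w i‖) := by
      field_simp
      ring
    have := mul_le_mul_of_nonneg_left h2 hμ.le
    linarith
  rw [Finset.mul_sum]
  refine (Finset.sum_le_sum fun i _ => h1 i).trans ?_
  rw [Finset.sum_add_distrib, ← Finset.mul_sum, ← Finset.mul_sum, ← Finset.mul_sum]
  have : 0 ≤ α / 2 * ‖d‖ ^ 2 := by positivity
  have := mul_le_mul_of_nonneg_left hK this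
  linarith

lemma rate_pos_and_lt_one {μ θ ω : ℝ} (hμ : 0 < μ) (hθ : 2 / (2 + μ) ≤ θ) (hθ1 : θ ≤ 1)
    (hω : ω = 2 * (1 + θ) / (4 + μ)) : 0 < ω ∧ ω < 1 := by
  have hθ0 : 0 < θ := lt_of_lt_of_le (by positivity) hθ
  subst hω
  refine ⟨by positivity, ?_⟩
  rw [div_lt_one (by positivity)]
  linarith

/-- Geometric decay of the Lyapunov function of the primal-dual iteration. -/
lemma lyapunov_rate (L : ∀ i, H →L[ℝ] G i) {γ μ θ ω : ℝ} {δ : Fin m → ℝ} (hγ : 0 < γ)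
    (hδ : ∀ i, 0 < δ i) (hμ : 0 < μ) (hK : μ ^ 2 * ∑ i, ‖L i‖ ^ 2 / δ i ≤ γ)
    (hθ : 2 / (2 + μ) ≤ θ) (hθ1 : θ ≤ 1) (hω : ω = 2 * (1 + θ) / (4 + μ))
    {x : ℕ → H} {xbar : H} {v : ∀ i, ℕ → G i} {vbar : ∀ i, G i}
    (hx : ∀ n, γ * (1 + μ / 2) * ‖x (n + 1) - xbar‖ ^ 2 + γ / 2 * ‖x (n + 1) - x n‖ ^ 2 ≤
      γ * ‖x n - xbar‖ ^ 2 - μ * ∑ i, inner ℝ (L i (x (n + 1) - xbar)) (v i n - vbar i))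
    (hv : ∀ i n, δ i * (1 + μ / 2) * ‖v i (n + 1) - vbar i‖ ^ 2 +
      δ i / 2 * ‖v i (n + 1) - v i n‖ ^ 2 ≤ δ i * ‖v i n - vbar i‖ ^ 2 +
        μ * inner ℝ (L i (x (n + 1) + θ • (x (n + 1) - x n) - xbar)) (v i (n + 1) - vbar i)) :
    ∀ n : ℕ,
      γ * ‖x (n + 1) - xbar‖ ^ 2 + (1 - ω) * ∑ i, δ i * ‖v i n - vbar i‖ ^ 2 ≤
        ω ^ n * (γ * ‖x 1 - xbar‖ ^ 2 + ∑ i, δ i * ‖v i 0 - vbar i‖ ^ 2 +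
          γ / 2 * ω * ‖x 1 - x 0‖ ^ 2 +
          μ * ω * ∑ i, inner ℝ (L i (x 1 - x 0)) (v i 0 - vbar i)) := by
  obtain ⟨hω0, hω1⟩ := rate_pos_and_lt_one hμ hθ hθ1 hω
  have hωe : ω * (4 + μ) = 2 * (1 + θ) := by rw [hω]; field_simp
  have hθω : ω ≤ θ := by
    have h1 := (div_le_iff₀ (by positivity : (0 : ℝ) < 2 + μ)).1 hθ
    have h2 : ω * (4 + μ) ≤ θ * (4 + μ) := by linarith
    exact le_of_mul_le_mul_right h2 (by positivity)
  set B : ℕ → ℝ := fun n => ∑ i, δ i * ‖v i n - vbar i‖ ^ 2 with hB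
  set Q : ℕ → ℝ := fun n => ∑ i, inner ℝ (L i (x (n + 1) - x n)) (v i n - vbar i) with hQ
  -- The primal variable is updated first, so `x (n + 1)` is paired with `v n`.
  set V : ℕ → ℝ := fun n => γ * ‖x (n + 1) - xbar‖ ^ 2 + B n +
    γ / 2 * ω * ‖x (n + 1) - x n‖ ^ 2 + μ * ω * Q n with hV
  have hstep : ∀ n, V (n + 1) ≤ ω * V n := by
    intro n
    have h1 := hx (n + 1)
    have h2 := Finset.sum_le_sum fun i (_ : i ∈ Finset.univ) => hv i n
    set d := x (n + 1) - x n with hd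
    set d' := x (n + 1 + 1) - x (n + 1) with hd'
    have e1 : x (n + 1) + θ • d - xbar = (x (n + 1 + 1) - xbar) - d' + θ • d := by
      rw [hd']
      abel
    rw [e1] at h2
    set E := ∑ i, δ i * ‖v i (n + 1) - v i n‖ ^ 2
    set R := ∑ i, inner ℝ (L i d) (v i (n + 1) - vbar i)
    set M := ∑ i, inner ℝ (L i (x (n + 1 + 1) - xbar)) (v i (n + 1) - vbar i)
    set Z := ∑ i, inner ℝ (L i d) (v i (n + 1) - v i n)
    -- Write `θ * R = ω * Q n + ω * Z + (θ - ω) * R`: the first term belongs to `ω * V n`, the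
    -- second is absorbed by `E`, the third by the surplus of `B (n + 1)`.
    have hRZ : R = Q n + Z := by
      simp only [R, Z, hQ, ← Finset.sum_add_distrib, ← hd]
      refine Finset.sum_congr rfl fun i _ => ?_
      rw [← inner_add_right, add_comm (v i n - vbar i), sub_add_sub_cancel]
    have h3 : (1 + μ / 2) * B (n + 1) + 1 / 2 * E ≤ B n + μ * (M - Q (n + 1) + θ * R) := by
      refine le_trans (le_of_eq ?_) (h2.trans (le_of_eq ?_))
      · rw [Finset.sum_add_distrib, Finset.mul_sum, Finset.mul_sum]
        congr 1 <;> refine Finset.sum_congr rfl fun i _ => ?_ <;> ring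
      · rw [Finset.sum_add_distrib, ← Finset.mul_sum]
        congr 2
        simp only [M, R, hQ, Finset.mul_sum, ← Finset.sum_sub_distrib, ← Finset.sum_add_distrib]
        refine Finset.sum_congr rfl fun i _ => ?_
        rw [map_add, map_sub, map_smul, inner_add_left, inner_sub_left, inner_smul_left]
        simp [hd']
    -- The weights `ω` and `ω / 2` make the dual squares match the available `E / 2` and `(θ - ω) *
    -- B (n + 1)` exactly.
    have h4 := coupling_le L hδ hω0 hμ hK d fun i => v i (n + 1) - v i n
    have h5 := coupling_le L hδ (half_pos hω0) hμ hK d fun i => v i (n + 1) - vbar i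
    have h4' : ω * (μ * Z) ≤ ω * (ω * (γ / 2)) * ‖d‖ ^ 2 + 1 / 2 * E := by
      refine (mul_le_mul_of_nonneg_left h4 hω0.le).trans (le_of_eq ?_)
      simp only [E]
      field_simp
    have h5' : ω * ((θ - ω) * (μ * R)) ≤ (θ - ω) * (ω * (ω / 2 * (γ / 2)) * ‖d‖ ^ 2 + B (n + 1)) := by
      refine (mul_le_mul_of_nonneg_left (mul_le_mul_of_nonneg_left h5 (sub_nonneg.2 hθω))
        hω0.le).trans (le_of_eq ?_)
      simp only [hB]
      field_simp
    have h6 : 0 ≤ γ * ‖x (n + 1 + 1) - xbar‖ ^ 2 := by positivity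
    have h7 : 1 ≤ ω * (1 + μ / 2) := by linarith
    have h8 := mul_le_mul_of_nonneg_right h7 h6
    have h9 := mul_le_mul_of_nonneg_left h1 hω0.le
    have h10 := mul_le_mul_of_nonneg_left h3 hω0.le
    have h11 := mul_le_mul_of_nonneg_left h4' hω0.le
    have hBe : ω * (1 + μ / 2) * B (n + 1) = (1 + θ - ω) * B (n + 1) := by
      congr 1
      linarith
    -- The two coupling bounds cost `ω + (θ - ω) / 2 = (ω + θ) / 2` of the square of `d` present in
    -- `ω * V n`.
    have h12 : ω * ω * (γ / 2) * ‖d‖ ^ 2 * ((ω + θ) / 2) ≤ ω * ω * (γ / 2) * ‖d‖ ^ 2 :=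
      mul_le_of_le_one_right (by positivity) (by linarith)
    simp only [hV]
    rw [← hd, ← hd']
    rw [hRZ] at h10 h5'
    linarith
  have hdecay : ∀ n, V n ≤ ω ^ n * V 0 := by
    intro n
    induction n with
    | zero => simp
    | succ n ih =>
      refine (hstep n).trans ?_
      rw [pow_succ', mul_assoc]
      exact mul_le_mul_of_nonneg_left ih hω0.le
  intro n
  refine le_trans ?_ (hdecay n)
  -- Weight `1` lets the step term of `V n` cancel exactly, at the cost of `ω / 2 * B n`.
  have h1 := coupling_le L hδ one_pos hμ hK (-(x (n + 1) - x n)) fun i => v i n - vbar i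
  simp only [map_neg, inner_neg_left, Finset.sum_neg_distrib, norm_neg] at h1
  have h2 := mul_le_mul_of_nonneg_left h1 hω0.le
  have h3 : 0 ≤ B n := Finset.sum_nonneg fun i _ => by have := hδ i; positivity
  simp only [hV, hQ, hB] at *
  nlinarith [mul_nonneg hω0.le h3]

end Rate

end PrimalDual

theorem theorem5 {H : Type*} [NormedAddCommGroup H] [InnerProductSpace ℝ H] [CompleteSpace H]
    {m : ℕ} (hm : 0 < m) {G : Fin m → Type*} [∀ i, NormedAddCommGroup (G i)]
    [∀ i, InnerProductSpace ℝ (G i)] [∀ i, CompleteSpace (G i)]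
    (z : H) (f : H → EReal) (hf : IsGamma f)
    (h : H → ℝ) (hconv : ConvexOn ℝ Set.univ h) (hdiff : Differentiable ℝ h)
    (η : ℝ) (hη : 0 < η) (hlip : ∀ x y : H, ‖gradient h x - gradient h y‖ ≤ η * ‖x - y‖)
    (r : ∀ i, G i) (g l : ∀ i, G i → EReal)
    (hg : ∀ i, IsGamma (g i)) (hl : ∀ i, IsGamma (l i))
    (ν : Fin m → ℝ) (hν : ∀ i, 0 < ν i) (hlν : ∀ i, IsStronglyConvex (ν i)⁻¹ (l i))
    (L : ∀ i, H →L[ℝ] G i) (hL : ∀ i, L i ≠ 0)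
    (γ : ℝ) (hγ : 0 < γ) (hfh : IsStronglyConvex γ fun x => f x + (h x : EReal))
    (δ : Fin m → ℝ) (hδ : ∀ i, 0 < δ i)
    (hgl : ∀ i, IsStronglyConvex (δ i) fun u => conj (g i) u + conj (l i) u)
    (hqual : r ∈ sqri ((Set.univ.pi fun i => effDom (g i) + effDom (l i)) -
      (fun (x : H) (i : Fin m) => L i x) '' effDom f)) :
    ∃ (xbar : H) (vbar : ∀ i, G i),
      -- `xbar` is the unique primal optimal solution
      (∀ x : H, (∀ x' : H, primalObj z f h r g l L x ≤ primalObj z f h r g l L x') ↔ x = xbar) ∧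
      -- `vbar` is the unique dual optimal solution
      (∀ v : ∀ i, G i, (∀ v' : ∀ i, G i, dualObj z f h r g l L v' ≤ dualObj z f h r g l L v) ↔
        v = vbar) ∧
      -- the optimality conditions
      z - ∑ i, ContinuousLinearMap.adjoint (L i) (vbar i) ∈
        subdiff f xbar + {gradient h xbar} ∧
      (∀ i, vbar i ∈ parSum (subdiff (g i)) (subdiff (l i)) (L i xbar - r i)) ∧
      -- zero duality gap
      (⨅ x : H, primalObj z f h r g l L x) = (⨆ v : ∀ i, G i, dualObj z f h r g l L v) ∧
      -- the sequences generated by the algorithm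
      ∀ (μ τ θ ω : ℝ) (σ : Fin m → ℝ),
        0 < μ → μ ≤ γ ^ 2 / η ^ 2 → (∀ i, μ ≤ δ i ^ 2 / ν i ^ 2) →
        μ ≤ Real.sqrt (γ / ∑ i, ‖L i‖ ^ 2 / δ i) →
        τ = μ / (2 * γ) → (∀ i, σ i = μ / (2 * δ i)) →
        2 / (2 + μ) ≤ θ → θ ≤ 1 → ω = 2 * (1 + θ) / (4 + μ) →
        0 < ω ∧ ω < 1 ∧
        ∀ (x y : ℕ → H) (v : ∀ i, ℕ → G i),
          (∀ n, x (n + 1) = prox τ f (x n - τ •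
            (∑ i, ContinuousLinearMap.adjoint (L i) (v i n) + gradient h (x n) - z))) →
          (∀ n, y n = x (n + 1) + θ • (x (n + 1) - x n)) →
          (∀ i n, v i (n + 1) = prox (σ i) (conj (g i)) (v i n + σ i •
            (L i (y n) - gradient (fun u => (conj (l i) u).toReal) (v i n) - r i))) →
          ∀ n : ℕ,
            γ * ‖x (n + 1) - xbar‖ ^ 2 + (1 - ω) * ∑ i, δ i * ‖v i n - vbar i‖ ^ 2 ≤
              ω ^ n * (γ * ‖x 1 - xbar‖ ^ 2 + ∑ i, δ i * ‖v i 0 - vbar i‖ ^ 2 +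
                γ / 2 * ω * ‖x 1 - x 0‖ ^ 2 +
                μ * ω * ∑ i, inner ℝ (L i (x 1 - x 0)) (v i 0 - vbar i)) := by
  have hsm := isSmoothConvex_gradient hconv hdiff hlip
  choose ψ W hψ hW hWs hWlip using fun i =>
    (hl i).exists_conj_eq_smooth (inv_pos.2 (hν i)) (hlν i).strongConvexEpi
  have hgl' := fun i => (hgl i).strongConvexEpi
  obtain ⟨xbar, vbar, P, hPx, hgrow, hPv, hdecr, hsub, hsubg⟩ :=
    exists_primal_dual_solution z hf hsm r hg L hγ hfh.strongConvexEpi hδ hgl' hψ hW hWs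
  have hPle : ∀ x, (P : EReal) ≤ primalObj z f h r g l L x := fun x =>
    EReal.le_of_forall_lt_iff_le.1 fun b hb => by
      have h1 := hgrow x b hb.le
      have h2 : 0 ≤ γ / 2 * ‖x - xbar‖ ^ 2 := by positivity
      exact_mod_cast (by linarith : P ≤ b)
  have hleP : ∀ v, dualObj z f h r g l L v ≤ P := fun v => by
    refine (hdecr v).trans ?_
    have : 0 ≤ ∑ i, δ i / 2 * ‖v i - vbar i‖ ^ 2 :=
      Finset.sum_nonneg fun i _ => by have := hδ i; positivity
    exact_mod_cast (by linarith : P - ∑ i, δ i / 2 * ‖v i - vbar i‖ ^ 2 ≤ P)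
  refine ⟨xbar, vbar, fun x => ⟨fun hx => ?_, ?_⟩, fun v => ⟨fun hv => ?_, ?_⟩, ?_, fun i => ?_,
    le_antisymm ?_ ?_, ?_⟩
  · have h1 := hgrow x P ((hx xbar).trans hPx.le)
    have h2 : ‖x - xbar‖ ^ 2 ≤ 0 := by nlinarith
    have h3 : ‖x - xbar‖ = 0 := pow_eq_zero_iff two_ne_zero |>.1 (le_antisymm h2 (sq_nonneg _))
    exact sub_eq_zero.1 (norm_eq_zero.1 h3)
  · rintro rfl x'
    rw [hPx]
    exact hPle x'
  · have h1 := (hv vbar).trans (hdecr v)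
    rw [hPv] at h1
    have h2 : P ≤ P - ∑ i, δ i / 2 * ‖v i - vbar i‖ ^ 2 := by exact_mod_cast h1
    have hnn : ∀ i ∈ Finset.univ, 0 ≤ δ i / 2 * ‖v i - vbar i‖ ^ 2 := fun i _ => by
      have := hδ i
      positivity
    have h3 := (Finset.sum_eq_zero_iff_of_nonneg hnn).1
      (le_antisymm (by linarith) (Finset.sum_nonneg hnn))
    funext i
    have h4 := h3 i (Finset.mem_univ i)
    have h5 := (mul_eq_zero.1 h4).resolve_left (half_pos (hδ i)).ne'
    exact sub_eq_zero.1 (norm_eq_zero.1 ((pow_eq_zero_iff two_ne_zero).1 h5))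
  · rintro rfl v'
    rw [hPv]
    exact hleP v'
  · exact Set.mem_add.2 ⟨_, hsub, _, Set.mem_singleton _, sub_add_cancel _ _⟩
  -- `parSum` unfolds to a splitting of `L i xbar - r i`, here with second summand `W i (vbar i)`.
  · exact Set.mem_add.2 ⟨_, hsubg i, _, hW i (vbar i), sub_add_cancel _ _⟩
  · exact (iInf_le _ xbar).trans (hPx.trans hPv.symm |>.le.trans (le_iSup _ vbar))
  · exact iSup_le fun v => (hleP v).trans (le_iInf hPle)
  intro μ τ θ ω σ hμ hμγ hμδ hμK hτ hσ hθ hθ1 hω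
  have hK : μ ^ 2 * ∑ i, ‖L i‖ ^ 2 / δ i ≤ γ := by
    have hK0 : 0 ≤ ∑ i, ‖L i‖ ^ 2 / δ i :=
      Finset.sum_nonneg fun i _ => by have := hδ i; positivity
    rcases hK0.eq_or_lt with h0 | h0
    · rw [← h0, mul_zero]
      exact hγ.le
    · exact (le_div_iff₀ h0).1 ((Real.le_sqrt' hμ).1 hμK)
  obtain ⟨hω0, hω1⟩ := rate_pos_and_lt_one hμ hθ hθ1 hω
  refine ⟨hω0, hω1, ?_⟩
  intro x y v hx hy hv
  refine lyapunov_rate L hγ hδ hμ hK hθ hθ1 hω (fun n => ?_) (fun i n => ?_)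
  · have h1 := forward_backward_step hf hsm hη hlip hγ hfh.strongConvexEpi hμ hμγ hτ
      (x := x n) (p := x (n + 1)) (xbar := xbar)
      (q := ∑ i, ContinuousLinearMap.adjoint (L i) (v i n) - z)
      (qbar := ∑ i, ContinuousLinearMap.adjoint (L i) (vbar i) - z)
      (by rw [hx n, sub_add_eq_add_sub]) (by rwa [neg_sub])
    refine h1.trans (le_of_eq ?_)
    rw [sub_sub_sub_cancel_right, ← Finset.sum_sub_distrib, sum_inner]
    congr 2
    refine Finset.sum_congr rfl fun i _ => ?_
    rw [← map_sub, ContinuousLinearMap.adjoint_inner_left, real_inner_comm]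
  · have hgrad : gradient (fun u => (conj (l i) u).toReal) (v i n) = W i (v i n) := by
      have : (fun u => (conj (l i) u).toReal) = ψ i := by
        funext u
        rw [hψ, EReal.toReal_coe]
      rw [this]
      exact ((hWs i).hasGradientAt _).gradient
    have hs : StrongConvexEpi (δ i) fun u => conj (g i) u + (ψ i u : EReal) := by
      simpa only [hψ] using hgl' i
    -- The dual update is the same step for `g i* + l i*`, with moduli `δ i` and `ν i`.
    have h1 := forward_backward_step (hg i).conj (hWs i) (hν i)
      (by simpa only [inv_inv] using hWlip i) (hδ i) hs hμ (hμδ i) (hσ i)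
      (x := v i n) (p := v i (n + 1)) (xbar := vbar i)
      (q := -(L i (y n) - r i)) (qbar := -(L i xbar - r i))
      (by
        rw [hv i n, hgrad]
        congr 1
        module)
      (by
        rw [neg_neg]
        exact mem_subdiff_conj (hsubg i))
    refine h1.trans (le_of_eq ?_)
    have e : -(L i (y n) - r i) - -(L i xbar - r i) = -(L i (y n - xbar)) := by
      rw [map_sub]
      abel
    rw [e, inner_neg_left, hy n]
    ring
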